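/- All Banach spaces are real and of dimension at least $1$, and all topological spaces are Hausdorff. Let $K$ be a compact space, $E$ a Banach space, and $\mathcal H$ a closed linear subspace of $\mathcal C(K,E)$, the space of continuous functions $K\to E$ with the supremum norm. We use the following notions. - For $f\in\mathcal C(K)=\mathcal C(K,\mathbb R)$ and $e\in E$, $f\otimes e\in\mathcal C(K,E)$ is the function $x\mapsto f(x)e$. Let $\mathcal A\subseteq\mathcal C(K)$ be the closed linear span of the functions $e^*\circ h$ with $h\in\mathcal H$, $e^*\in E^*$, and let $\mathcal A^E$ be the set of all $f\in\mathcal A$ such that $f\otimes e\in\mathcal H$ for each $e\in E$. - The Choquet boundary $\operatorname{Ch}_{\mathcal H}K$ is the set of all $x\in K$ such that the functional $f\mapsto f(x)$ on $\mathcal A$ is an extreme point of the closed unit ball of $\mathcal A^*$. - A point $x\in K$ is a weak peak point with respect to $\mathcal H$ if for each neighbourhood $U$ of $x$ and each $\varepsilon\in(0,1)$ there exists $h\in\mathcal A^E$ with $0\le h\le 1$, $h(x)>1-\varepsilon$ and $h<\varepsilon$ on $\operatorname{Ch}_{\mathcal H}K\setminus U$. The set of weak peak points is denoted by $\mathcal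 W_{\mathcal H}$. - $\Omega_{\mathcal H}=\{y\in K:\ g(y)\ne0\text{ for some }g\in\mathcal H\}$. - A set $\mathcal B\subseteq K$ is a boundary for $\mathcal H$ if $\|h\|=\sup_{x\in\mathcal B}\|h(x)\|$ for each $h\in\mathcal H$. - For a set $S\subseteq K$, regarded as a topological space with the subspace topology, $S^{(0)}=S$ and $S^{(j+1)}$ is the set of those points of $S^{(j)}$ that are accumulation points of $S^{(j)}$. - A Banach space $Y$ contains an isomorphic copy of a Banach space $X$ if $X$ is linearly homeomorphic to a subspace of $Y$. An into isomorphism $T:X\to Y$ is a linear homeomorphism of $X$ onto a subspace $T(X)$ of $Y$, and $T^{-1}:T(X)\to X$ is its inverse. **Theorem 1.3.** For $i=1,2$, let $K_i$ be a compact space, $E_i$ a Banach space and $\mathcal H_i$ a closed subspace of $\mathcal C(K_i,E_i)$. Let $E_2$ contain no isomorphic copy of $c_0$, let $\mathcal B$ be a closed boundary for $\mathcal H_2$, and let $T:\mathcal H_1\to\mathcal H_2$ be an into isomorphism. Let $l\ge k\ge1$ be integers. Suppose that one of the following conditions holds: (i) $\mathcal W_{\mathcal H_1}^{(l)}$ is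 nonempty and $\mathcal B^{(k)}\cap\Omega_{\mathcal H_2}$ is empty; (ii) $\mathcal W_{\mathcal H_1}^{(l)}$ is infinite and $\mathcal B^{(k)}\cap\Omega_{\mathcal H_2}$ is finite; (iii) $\mathcal W_{\mathcal H_1}^{(l)}$ and $\mathcal B^{(k)}\cap\Omega_{\mathcal H_2}$ are both finite, and $E_2^m$ contains no isomorphic copy of $E_1^n$, where $n=|\mathcal W_{\mathcal H_1}^{(l)}|$ and $m=|\mathcal B^{(k)}\cap\Omega_{\mathcal H_2}|$. Then $$\|T\|\,\|T^{-1}\|\ \ge\ \max\Bigl\{3,\ \frac{2l+2-k}{k}\Bigr\}.$$ -/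

import Mathlib

set_option maxSynthPendingDepth 10

open Set Topology

/-- `Y` contains an isomorphic copy of `X`: `X` is linearly homeomorphic to a linear subspace
of `Y` (which is automatically closed when `X` is complete). -/
def ContainsCopy (Y X : Type*) [NormedAddCommGroup Y] [NormedSpace ℝ Y]
    [NormedAddCommGroup X] [NormedSpace ℝ X] : Prop :=
  ∃ F : Submodule ℝ Y, Nonempty (X ≃L[ℝ] F)

section FunctionSpaces

/- `C(K, E)` carries the supremum norm, as `K` is compact. -/
variable {K E : Type*} [TopologicalSpace K] [CompactSpace K]
  [NormedAddCommGroup E] [NormedSpace ℝ E]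

/-- The function `f ⊗ e`, that is `x ↦ f x • e`. -/
def tensorVec (f : C(K, ℝ)) (e : E) : C(K, E) :=
  ⟨fun x => f x • e, by fun_prop⟩

/-- The canonical scalar function space `𝒜` of `H`: the closed linear span in `C(K, ℝ)` of the
functions `x ↦ φ (h x)`, where `h ∈ H` and `φ` is in the dual of `E`. -/
noncomputable def scalarSpace (H : Submodule ℝ C(K, E)) : Submodule ℝ C(K, ℝ) :=
  (Submodule.span ℝ
    {f : C(K, ℝ) | ∃ φ : StrongDual ℝ E, ∃ h ∈ H, ∀ x, f x = φ (h x)}).topologicalClosure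

/-- The set `𝒜^E` of those `f ∈ 𝒜` such that `f ⊗ e ∈ H` for every `e ∈ E`. -/
def tensorMultipliers (H : Submodule ℝ C(K, E)) : Set C(K, ℝ) :=
  {f | f ∈ scalarSpace H ∧ ∀ e : E, tensorVec f e ∈ H}

/-- The evaluation functional `h ↦ h x` on a subspace `A` of `C(K, ℝ)`. -/
noncomputable def evalOn (A : Submodule ℝ C(K, ℝ)) (x : K) : StrongDual ℝ A :=
  (ContinuousMap.evalCLM ℝ x).comp A.subtypeL

/-- The Choquet boundary of `H`: the points `x` whose evaluation functional is an extreme point of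
the closed unit ball of the dual of the canonical scalar function space of `H`. -/
def choquetBoundary (H : Submodule ℝ C(K, E)) : Set K :=
  {x | evalOn (scalarSpace H) x ∈
    (Metric.closedBall (0 : StrongDual ℝ (scalarSpace H)) 1).extremePoints ℝ}

/-- The set `𝒲_H` of weak peak points with respect to `H`. -/
def weakPeakPoints (H : Submodule ℝ C(K, E)) : Set K :=
  {x | ∀ U ∈ 𝓝 x, ∀ ε : ℝ, 0 < ε → ε < 1 →
    ∃ h ∈ tensorMultipliers H, (∀ y, 0 ≤ h y ∧ h y ≤ 1) ∧ 1 - ε < h x ∧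
      ∀ y ∈ choquetBoundary H \ U, h y < ε}

/-- The set `Ω_H` of points at which some member of `H` does not vanish. -/
def nonvanishingSet (H : Submodule ℝ C(K, E)) : Set K :=
  {y | ∃ g ∈ H, g y ≠ 0}

/-- `B` is a boundary for `H`: `‖h‖ = sup_{x ∈ B} ‖h x‖` for every `h ∈ H`. (The supremum is that
of a bounded set of nonnegative reals, and is `0` when `B` is empty.) -/
def IsBoundaryFor (B : Set K) (H : Submodule ℝ C(K, E)) : Prop :=
  ∀ h ∈ H, ‖h‖ = ⨆ x : B, ‖h x‖

end FunctionSpaces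

/-! ### Milman's converse of the Krein–Milman theorem -/

section Milman

variable {V : Type*} [AddCommGroup V] [Module ℝ V] [TopologicalSpace V]
  [IsTopologicalAddGroup V] [ContinuousSMul ℝ V]

/-! Descending through the derivatives of the set of weak peak points from order `l` to order `0`
yields functions `h 0, …, h l` in the domain, all close to one unit vector `e` at a common point.
They are nested: on the Choquet boundary, wherever a later function is not small, it is a multiple
`t • e` with `0 ≤ t ≤ 1` and all earlier ones are close to `e`.

The images are controlled by a count: a point of the `j`-th derivative of `B` sees at most `k - j`
large images. For `j < k` the points where this bound is attained are finite in number, since by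
semicontinuity an accumulation point, which lies in the next derivative, would see too many. For `j
= k` finiteness is the hypothesis on `D`. Without copies of `c₀` in `E₂`, the Bessaga-Pełczyński
theorem (`tendsto_zero_of_norm_sum_le`) makes the images of functions peaking on disjoint open sets
tend to zero pointwise, so the next function can have a small image at these finitely many points.
The three alternative hypotheses serve to start the chain, with `h 0` having small image on `D`.

At every point of `B` at most `k` of the `l + 1` images are then large. Up to small errors,
nestedness gives norm at most `1` to `h i`, to `2 h j - h i` for `i < j`, and to `2 h l - 2 h i + h
0` for `0 < i < l`. Testing the operator on `∑ w i • h i`, with weights `1` for `i < k` and `2`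
afterwards, gives `(2l + 2 - k) / k`; testing on `2 h l + h 0` gives `3`.

Norms in the domain are estimated only on the Choquet boundary, which is legitimate by
`norm_le_of_forall_choquetBoundary`. -/

theorem IsCompact.convexHull_union_of_convex {s t : Set V} (hs : IsCompact s) (ht : IsCompact t)
    (hs' : Convex ℝ s) (ht' : Convex ℝ t) : IsCompact (convexHull ℝ (s ∪ t)) := by
  rcases s.eq_empty_or_nonempty with rfl | hsn
  · simpa [ht'.convexHull_eq] using ht
  rcases t.eq_empty_or_nonempty with rfl | htn
  · simpa [hs'.convexHull_eq] using hs
  rw [convexHull_union hsn htn, hs'.convexHull_eq, ht'.convexHull_eq]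
  have himage : convexJoin ℝ s t =
      (fun p : (V × V) × ℝ => (1 - p.2) • p.1.1 + p.2 • p.1.2) '' ((s ×ˢ t) ×ˢ Icc 0 1) := by
    ext x
    simp only [mem_convexJoin, segment_eq_image, mem_image]
    constructor
    · rintro ⟨a, ha, b, hb, θ, hθ, rfl⟩
      exact ⟨((a, b), θ), ⟨⟨ha, hb⟩, hθ⟩, rfl⟩
    · rintro ⟨⟨⟨a, b⟩, θ⟩, ⟨⟨ha, hb⟩, hθ⟩, rfl⟩
      exact ⟨a, ha, b, hb, θ, hθ, rfl⟩
  rw [himage]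
  exact ((hs.prod ht).prod isCompact_Icc).image (by fun_prop)

/-- **Milman's converse** of the Krein-Milman theorem. -/
theorem extremePoints_closure_convexHull_subset [T2Space V] [LocallyConvexSpace ℝ V] {Q : Set V}
    (hQ : IsCompact Q) (hC : IsCompact (closure (convexHull ℝ Q))) :
    (closure (convexHull ℝ Q)).extremePoints ℝ ⊆ Q := by
  intro p hp
  by_contra hpQ
  have hconv : Convex ℝ (closure (convexHull ℝ Q)) := (convex_convexHull ℝ Q).closure
  have hQC : Q ⊆ closure (convexHull ℝ Q) := (subset_convexHull ℝ Q).trans subset_closure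
  obtain ⟨D, hDc, hDconv, hQD, -, hpD⟩ : ∃ D : Set V, IsCompact D ∧ Convex ℝ D ∧ Q ⊆ D ∧
      D ⊆ closure (convexHull ℝ Q) ∧ p ∉ D := by
    -- Compactness glues local pieces: each point of `Q` has a neighbourhood in `Q` contained in a
    -- half-space slice of the hull that misses `p`.
    refine hQ.induction_on (p := fun s => ∃ D : Set V, IsCompact D ∧ Convex ℝ D ∧ s ⊆ D ∧
      D ⊆ closure (convexHull ℝ Q) ∧ p ∉ D) ?_ ?_ ?_ ?_
    · exact ⟨∅, isCompact_empty, convex_empty, Subset.rfl, empty_subset _, notMem_empty _⟩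
    · rintro s t hst ⟨D, h1, h2, h3, h4⟩
      exact ⟨D, h1, h2, hst.trans h3, h4⟩
    · rintro s t ⟨D, hD, hD', hsD, hDC, hpD⟩ ⟨D', hE, hE', htE, hEC, hpE⟩
      have hsub : convexHull ℝ (D ∪ D') ⊆ closure (convexHull ℝ Q) :=
        convexHull_min (union_subset hDC hEC) hconv
      refine ⟨convexHull ℝ (D ∪ D'), hD.convexHull_union_of_convex hE hD' hE',
        convex_convexHull ℝ _, (union_subset_union hsD htE).trans (subset_convexHull ℝ _), hsub,
        fun hmem => ?_⟩
      -- If `p` lay in the smaller hull it would be extreme there too, hence a point of one of the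
      -- two generating sets.
      have := extremePoints_convexHull_subset
        (inter_extremePoints_subset_extremePoints_of_subset hsub ⟨hmem, hp⟩)
      exact this.elim hpD hpE
    · intro q hq
      have hpq : p ≠ q := fun h => hpQ (h ▸ hq)
      obtain ⟨f, hf⟩ := geometric_hahn_banach_point_point hpq
      refine ⟨{v | (f p + f q) / 2 < f v} ∩ Q, ?_,
        closure (convexHull ℝ Q) ∩ {v | (f p + f q) / 2 ≤ f v}, ?_, ?_, ?_, inter_subset_left, ?_⟩
      · exact Filter.inter_mem (mem_nhdsWithin_of_mem_nhds
          ((isOpen_lt continuous_const f.continuous).mem_nhds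
            (by simp only [mem_ofPred_eq]; linarith))) self_mem_nhdsWithin
      · exact hC.inter_right (isClosed_le continuous_const f.continuous)
      · exact hconv.inter (convex_halfSpace_ge f.isLinear _)
      · rintro v ⟨hv, hvQ⟩
        exact ⟨hQC hvQ, (show _ < f v from hv).le⟩
      · rintro ⟨-, h⟩
        simp only [mem_ofPred_eq] at h
        linarith
  exact hpD (closure_minimal (convexHull_min hQD hDconv) hDc.isClosed hp.1)

end Milman

/-! ### The Choquet boundary as a norming set -/

section Choquet

instance WeakDual.instLocallyConvexSpace {V : Type*} [NormedAddCommGroup V] [NormedSpace ℝ V] :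
    LocallyConvexSpace ℝ (WeakDual ℝ V) :=
  WeakBilin.locallyConvexSpace (B := topDualPairing ℝ V)

variable {K : Type*} [TopologicalSpace K] [CompactSpace K]

theorem norm_evalOn_le (A : Submodule ℝ C(K, ℝ)) (x : K) : ‖evalOn A x‖ ≤ 1 :=
  ContinuousLinearMap.opNorm_le_bound _ zero_le_one fun f => by
    simpa [evalOn] using (f : C(K, ℝ)).norm_coe_le_norm x

theorem neg_mem_extremePoints_closedBall {V : Type*} [NormedAddCommGroup V] [NormedSpace ℝ V]
    {r : ℝ} {v : V} (hv : -v ∈ (Metric.closedBall (0 : V) r).extremePoints ℝ) :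
    v ∈ (Metric.closedBall (0 : V) r).extremePoints ℝ := by
  rw [mem_extremePoints_iff_left] at hv ⊢
  refine ⟨by simpa using hv.1, fun a ha b hb hab => ?_⟩
  have := hv.2 (-a) (by simpa using ha) (-b) (by simpa using hb) (by
    obtain ⟨s, t, hs, ht, hst, rfl⟩ := hab
    exact ⟨s, t, hs, ht, hst, by simp only [smul_neg]; abel⟩)
  exact neg_injective this

theorem weakDual_closedBall_eq [Nonempty K] (A : Submodule ℝ C(K, ℝ)) :
    (WeakDual.toStrongDual ⁻¹' Metric.closedBall (0 : StrongDual ℝ A) 1 : Set (WeakDual ℝ A)) =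
      closure (convexHull ℝ
        (range (fun x => StrongDual.toWeakDual (evalOn A x)) ∪
          range (fun x => StrongDual.toWeakDual (-evalOn A x)))) := by
  apply Subset.antisymm
  · intro φ hφ
    by_contra hnot
    obtain ⟨l, r, hl, hr⟩ := geometric_hahn_banach_closed_point (convex_convexHull ℝ _).closure
      isClosed_closure hnot
    -- Weak-star continuous functionals are evaluations at elements `g` of `A`; separation then says
    -- that `‖g‖ ≤ r < φ g` with `‖φ‖ ≤ 1`.
    obtain ⟨g, rfl⟩ := LinearMap.dualEmbedding_surjective (topDualPairing ℝ A) l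
    have hg : ∀ x, |(g : C(K, ℝ)) x| ≤ r := fun x => by
      have h1 := hl _ (subset_closure (subset_convexHull ℝ _ (Or.inl ⟨x, rfl⟩)))
      have h2 := hl _ (subset_closure (subset_convexHull ℝ _ (Or.inr ⟨x, rfl⟩)))
      change (g : C(K, ℝ)) x < r at h1
      change -(g : C(K, ℝ)) x < r at h2
      exact abs_le.2 ⟨by linarith, h1.le⟩
    change r < φ g at hr
    have hr0 : 0 ≤ r := (abs_nonneg _).trans (hg (Classical.arbitrary K))
    have hgr : ‖g‖ ≤ r := (ContinuousMap.norm_le _ hr0).2 hg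
    have hφ1 : ‖WeakDual.toStrongDual φ‖ ≤ 1 := by simpa using hφ
    have : φ g ≤ r := calc
      φ g ≤ ‖WeakDual.toStrongDual φ g‖ := le_abs_self _
      _ ≤ ‖WeakDual.toStrongDual φ‖ * ‖g‖ := ContinuousLinearMap.le_opNorm _ _
      _ ≤ 1 * r := by gcongr
      _ = r := one_mul r
    linarith
  · refine closure_minimal (convexHull_min ?_ ?_) (WeakDual.isClosed_closedBall 0 1)
    · rintro _ (⟨x, rfl⟩ | ⟨x, rfl⟩)
      · simpa using norm_evalOn_le A x
      · simpa using norm_evalOn_le A x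
    · exact (convex_closedBall (0 : StrongDual ℝ A) 1).linear_preimage _

/-- By Banach–Alaoglu the functional "evaluate at `f`" attains its maximum over the dual ball on a
compact exposed face. An extreme point of that face is extreme in the ball, so by Milman it is plus
or minus a point evaluation; the sign accounts for the absolute value. -/
theorem exists_extreme_evalOn (A : Submodule ℝ C(K, ℝ)) (f : A) (x : K) :
    ∃ z, evalOn A z ∈ (Metric.closedBall (0 : StrongDual ℝ A) 1).extremePoints ℝ ∧
      (f : C(K, ℝ)) x ≤ |(f : C(K, ℝ)) z| := by
  have : Nonempty K := ⟨x⟩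
  set Q : Set (WeakDual ℝ A) := range (fun x => StrongDual.toWeakDual (evalOn A x)) ∪
          range (fun x => StrongDual.toWeakDual (-evalOn A x)) with hQdef
  set b : Set (WeakDual ℝ A) := WeakDual.toStrongDual ⁻¹' Metric.closedBall (0 : StrongDual ℝ A) 1
    with hb
  have hbQ : b = closure (convexHull ℝ Q) := weakDual_closedBall_eq A
  have hbc : IsCompact b := WeakDual.isCompact_closedBall 0 1
  have hcont : Continuous (fun x => StrongDual.toWeakDual (evalOn A x)) :=
    WeakBilin.continuous_of_continuous_eval _ fun g => (g : C(K, ℝ)).continuous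
  have hQ : IsCompact Q := by
    refine (isCompact_range hcont).union ?_
    have := isCompact_range hcont.neg
    exact this
  have hxb : StrongDual.toWeakDual (evalOn A x) ∈ b := by
    rw [hbQ]
    exact subset_closure (subset_convexHull ℝ _ (Or.inl ⟨x, rfl⟩))
  let l : StrongDual ℝ (WeakDual ℝ A) := WeakBilin.eval (topDualPairing ℝ A) f
  have hexp : IsExposed ℝ b {φ ∈ b | ∀ ψ ∈ b, l ψ ≤ l φ} := fun _ => ⟨l, rfl⟩
  obtain ⟨φ, hφb, hφ⟩ := hbc.exists_isMaxOn ⟨_, hxb⟩ l.continuous.continuousOn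
  obtain ⟨p, hp⟩ := (hexp.isCompact hbc).extremePoints_nonempty ⟨φ, hφb, hφ⟩
  have hpmax : ∀ ψ ∈ b, l ψ ≤ l p := hp.1.2
  have hpb : p ∈ b.extremePoints ℝ := hexp.isExtreme.extremePoints_subset_extremePoints hp
  have hpQ : p ∈ Q := extremePoints_closure_convexHull_subset hQ (hbQ ▸ hbc) (hbQ ▸ hpb)
  have hpS : WeakDual.toStrongDual p ∈ (Metric.closedBall (0 : StrongDual ℝ A) 1).extremePoints ℝ := by
    rw [mem_extremePoints_iff_left] at hpb ⊢
    exact hpb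
  have hxp : (f : C(K, ℝ)) x ≤ l p := hpmax _ hxb
  rcases hpQ with ⟨z, rfl⟩ | ⟨z, rfl⟩
  · exact ⟨z, hpS, hxp.trans (le_abs_self _)⟩
  · exact ⟨z, neg_mem_extremePoints_closedBall hpS, hxp.trans (neg_le_abs _)⟩

variable {E : Type*} [NormedAddCommGroup E] [NormedSpace ℝ E]

/-- The maximum principle behind every norm estimate in the domain: compose with a norming
functional at an arbitrary point and apply the scalar case. -/
theorem norm_le_of_forall_choquetBoundary {H : Submodule ℝ C(K, E)} (u : H)
    {c : ℝ} (hc : 0 ≤ c) (h : ∀ z ∈ choquetBoundary H, ‖(u : C(K, E)) z‖ ≤ c) : ‖u‖ ≤ c := by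
  obtain ⟨u, hu⟩ := u
  change ‖u‖ ≤ c
  refine (ContinuousMap.norm_le _ hc).2 fun x => ?_
  obtain ⟨φ, hφ, hφx⟩ := exists_dual_vector'' ℝ (u x)
  let f : C(K, ℝ) := ⟨fun y => φ (u y), by fun_prop⟩
  have hf : f ∈ scalarSpace H :=
    Submodule.le_topologicalClosure _ (Submodule.subset_span ⟨φ, u, hu, fun _ => rfl⟩)
  obtain ⟨z, hz, hxz⟩ := exists_extreme_evalOn (scalarSpace H) ⟨f, hf⟩ x
  calc ‖u x‖ = f x := hφx.symm
    _ ≤ |f z| := hxz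
    _ ≤ ‖φ‖ * ‖u z‖ := φ.le_opNorm _
    _ ≤ 1 * c := by gcongr; exact h z hz
    _ = c := one_mul c

end Choquet

/-! ### Weakly unconditionally Cauchy series and copies of `c₀` -/

section CopiesOfCZero

open Filter

/-- A bounded-below operator witnesses an isomorphic copy. -/
theorem containsCopy_of_bounded_below {X Y : Type*} [NormedAddCommGroup X] [NormedSpace ℝ X]
    [NormedAddCommGroup Y] [NormedSpace ℝ Y] (f : X →ₗ[ℝ] Y) {c C : ℝ} (hc : 0 < c)
    (hlow : ∀ x, c * ‖x‖ ≤ ‖f x‖) (hup : ∀ x, ‖f x‖ ≤ C * ‖x‖) : ContainsCopy Y X := by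
  have hinj : Function.Injective f := by
    refine (injective_iff_map_eq_zero f).2 fun x hx => ?_
    have := hlow x
    rw [hx, norm_zero] at this
    exact norm_le_zero_iff.1 (by nlinarith [norm_nonneg x])
  refine ⟨LinearMap.range f, ⟨(LinearEquiv.ofInjective f hinj).toContinuousLinearEquivOfBounds
    C c⁻¹ (fun x => hup x) fun y => ?_⟩⟩
  obtain ⟨x, rfl⟩ := (LinearEquiv.ofInjective f hinj).surjective y
  rw [LinearEquiv.symm_apply_apply, inv_mul_eq_div, le_div_iff₀ hc, mul_comm]
  exact hlow x

/-- **Rosenthal's lemma** for a nonnegative matrix with bounded row sums on an infinite set. -/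
theorem exists_infinite_offDiag_sum_le {a : ℕ → ℕ → ℝ} {ε : ℝ} (hε : 0 ≤ ε) (N : ℕ) {S : Set ℕ}
    (hS : S.Infinite) (h : ∀ n ∈ S, ∀ F : Finset ℕ, ↑F ⊆ S → ∑ m ∈ F, a n m ≤ N * ε) :
    ∃ M ⊆ S, M.Infinite ∧
      ∀ n ∈ M, ∀ F : Finset ℕ, ↑F ⊆ M → n ∉ F → ∑ m ∈ F, a n m ≤ ε := by
  induction N generalizing S with
  | zero => exact ⟨S, Subset.rfl, hS, fun n hn F hF _ => (h n hn F hF).trans (by simpa using hε)⟩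
  | succ N ih =>
    let g : ℕ → ℕ → ℕ := fun p q => hS.natEmbedding S (Nat.pair p q)
    have hgS : ∀ p q, g p q ∈ S := fun p q => (hS.natEmbedding S (Nat.pair p q)).2
    have hg : ∀ p q p' q', g p q = g p' q' → p = p' ∧ q = q' := fun p q p' q' he =>
      Nat.pair_eq_pair.1 ((hS.natEmbedding S).injective (Subtype.ext he))
    by_cases hgood : ∃ p, ∀ n ∈ range (g p), ∀ F : Finset ℕ, ↑F ⊆ range (g p) → n ∉ F →
        ∑ m ∈ F, a n m ≤ ε
    · obtain ⟨p, hp⟩ := hgood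
      exact ⟨range (g p), by rintro _ ⟨q, rfl⟩; exact hgS p q,
        infinite_range_of_injective fun q q' he => (hg _ _ _ _ he).2, hp⟩
    · push Not at hgood
      -- `S` has been cut into infinitely many disjoint infinite pieces, all bad. A bad row `n p`
      -- spends more than `ε` on `F p` inside its own piece, disjoint from the other chosen indices,
      -- so restricting to the chosen rows lowers the row bound by `ε`.
      choose n hn F hF hnF hsum using hgood
      choose q hq using hn
      have hinj : Function.Injective n := fun p p' he => by
        rw [← hq p, ← hq p'] at he
        exact (hg _ _ _ _ he).1
      have hnS : range n ⊆ S := by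
        rintro _ ⟨p, rfl⟩
        rw [← hq p]
        exact hgS _ _
      obtain ⟨M, hM, hM'⟩ := ih (infinite_range_of_injective hinj) (by
        rintro _ ⟨p, rfl⟩ G hG
        have hdisj : Disjoint G (F p) := by
          refine Finset.disjoint_left.2 fun m hmG hmF => ?_
          obtain ⟨p', rfl⟩ := hG hmG
          obtain ⟨q', hq'⟩ := hF p hmF
          rw [← hq p'] at hq'
          obtain rfl := (hg _ _ _ _ hq').1
          exact hnF p hmF
        have hsub : (↑(G ∪ F p) : Set ℕ) ⊆ S := by
          rw [Finset.coe_union]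
          refine union_subset (hG.trans hnS) ((hF p).trans ?_)
          rintro _ ⟨q', rfl⟩
          exact hgS _ _
        have := h (n p) (hnS ⟨p, rfl⟩) _ hsub
        rw [Finset.sum_union hdisj] at this
        push_cast at this
        linarith [hsum p])
      exact ⟨M, hM.trans hnS, hM'⟩

variable {E : Type*} [NormedAddCommGroup E] [NormedSpace ℝ E]

theorem sum_abs_dual_le {x : ℕ → E} {C : ℝ}
    (h : ∀ F : Finset ℕ, ∀ s : ℕ → ℝ, (∀ n, |s n| ≤ 1) → ‖∑ n ∈ F, s n • x n‖ ≤ C)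
    (φ : StrongDual ℝ E) (hφ : ‖φ‖ ≤ 1) (F : Finset ℕ) : ∑ n ∈ F, |φ (x n)| ≤ C := by
  calc ∑ n ∈ F, |φ (x n)| = φ (∑ n ∈ F, (SignType.sign (φ (x n)) : ℝ) • x n) := by
        rw [map_sum]
        refine Finset.sum_congr rfl fun n _ => ?_
        rw [map_smul, smul_eq_mul, sign_mul_self]
    _ ≤ ‖φ‖ * ‖∑ n ∈ F, (SignType.sign (φ (x n)) : ℝ) • x n‖ :=
        (le_abs_self _).trans (φ.le_opNorm _)
    _ ≤ 1 * C := by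
        gcongr
        refine h F (fun n => (SignType.sign (φ (x n)) : ℝ)) fun n => ?_
        rcases SignType.trichotomy (SignType.sign (φ (x n))) with h | h | h <;> simp [h]
    _ = C := one_mul C

theorem norm_sum_smul_le {ι : Type*} {x : ι → E} {C : ℝ}
    (h : ∀ φ : StrongDual ℝ E, ‖φ‖ ≤ 1 → ∀ F : Finset ι, ∑ n ∈ F, |φ (x n)| ≤ C)
    {c : ι → ℝ} {r : ℝ} (hr : 0 ≤ r) (F : Finset ι) (hc : ∀ n ∈ F, |c n| ≤ r) :
    ‖∑ n ∈ F, c n • x n‖ ≤ r * C := by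
  obtain ⟨φ, hφ, hφx⟩ := exists_dual_vector'' ℝ (∑ n ∈ F, c n • x n)
  calc ‖∑ n ∈ F, c n • x n‖ = φ (∑ n ∈ F, c n • x n) := hφx.symm
    _ = ∑ n ∈ F, c n * φ (x n) := by simp [map_sum]
    _ ≤ ∑ n ∈ F, r * |φ (x n)| := Finset.sum_le_sum fun n hn => by
        refine (le_abs_self _).trans ?_
        rw [abs_mul]
        gcongr
        exact hc n hn
    _ = r * ∑ n ∈ F, |φ (x n)| := by rw [Finset.mul_sum]
    _ ≤ r * C := by gcongr; exact h φ hφ F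

/-- The embedding is `c ↦ ∑ c n • y n`. Testing with `ψ n` bounds the norm below by `|c n| δ - ‖c‖ δ
/ 2`, and the supremum over `n` leaves `‖c‖ δ / 2`. -/
theorem containsCopy_czero_of_biorthogonal [CompleteSpace E] {y : ℕ → E} {C δ : ℝ} (hδ : 0 < δ)
    (h : ∀ φ : StrongDual ℝ E, ‖φ‖ ≤ 1 → ∀ F : Finset ℕ, ∑ n ∈ F, |φ (y n)| ≤ C)
    (ψ : ℕ → StrongDual ℝ E) (hψ : ∀ n, ‖ψ n‖ ≤ 1) (hdiag : ∀ n, δ ≤ ψ n (y n))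
    (hoff : ∀ n, ∀ F : Finset ℕ, n ∉ F → ∑ m ∈ F, |ψ n (y m)| ≤ δ / 2) :
    ContainsCopy E (ZeroAtInftyContinuousMap ℕ ℝ) := by
  have hC : 0 ≤ C := by simpa using h 0 (by simp) ∅
  have habs : ∀ (c : ZeroAtInftyContinuousMap ℕ ℝ) n, |c n| ≤ ‖c‖ := fun c n => by
    rw [← ZeroAtInftyContinuousMap.norm_toBCF_eq_norm]
    exact c.toBCF.norm_coe_le_norm n
  have hsum : ∀ c : ZeroAtInftyContinuousMap ℕ ℝ, Summable fun n => c n • y n := fun c => by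
    rw [summable_iff_vanishing_norm]
    intro e he
    have hc : Tendsto c cofinite (𝓝 0) := by
      rw [Nat.cofinite_eq_atTop]
      simpa using c.zero_at_infty'
    have := hc.eventually (Metric.ball_mem_nhds (0 : ℝ) (show 0 < e / (C + 1) by positivity))
    rw [eventually_cofinite] at this
    refine ⟨this.toFinset, fun t ht => ?_⟩
    refine (norm_sum_smul_le h (r := e / (C + 1)) (by positivity) t fun n hn => ?_).trans_lt ?_
    · by_contra hlt
      refine Finset.disjoint_left.1 ht hn ?_
      simp only [Finite.mem_toFinset, mem_ofPred_eq, dist_zero_right,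
        Real.norm_eq_abs]
      exact fun h' => hlt h'.le
    · rw [div_mul_eq_mul_div, div_lt_iff₀ (by positivity)]
      nlinarith
  let S : ZeroAtInftyContinuousMap ℕ ℝ →ₗ[ℝ] E :=
    { toFun := fun c => ∑' n, c n • y n
      map_add' := fun c d => by
        simp only [ZeroAtInftyContinuousMap.add_apply, add_smul]
        exact (hsum c).tsum_add (hsum d)
      map_smul' := fun r c => by
        simp only [ZeroAtInftyContinuousMap.smul_apply, smul_assoc, RingHom.id_apply]
        exact (hsum c).tsum_const_smul r }
  have hS : ∀ c, Tendsto (fun F : Finset ℕ => ∑ n ∈ F, c n • y n) atTop (𝓝 (S c)) :=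
    fun c => (hsum c).hasSum
  refine containsCopy_of_bounded_below S (c := δ / 2) (C := C) (by positivity) (fun c => ?_)
    fun c => ?_
  · have hn : ∀ n, |c n| * δ - ‖c‖ * (δ / 2) ≤ ‖S c‖ := fun n => by
      refine ge_of_tendsto (hS c).norm ?_
      filter_upwards [eventually_ge_atTop {n}] with F hF
      have hnF : n ∈ F := by simpa using hF
      have h1 : ψ n (∑ m ∈ F, c m • y m) =
          c n * ψ n (y n) + ∑ m ∈ F.erase n, c m * ψ n (y m) := by
        rw [map_sum, ← Finset.add_sum_erase _ _ hnF]
        simp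
      have h2 : |∑ m ∈ F.erase n, c m * ψ n (y m)| ≤ ‖c‖ * (δ / 2) := calc
        |∑ m ∈ F.erase n, c m * ψ n (y m)| ≤ ∑ m ∈ F.erase n, |c m * ψ n (y m)| :=
          Finset.abs_sum_le_sum_abs _ _
        _ ≤ ∑ m ∈ F.erase n, ‖c‖ * |ψ n (y m)| := Finset.sum_le_sum fun m _ => by
          rw [abs_mul]
          gcongr
          exact habs c m
        _ = ‖c‖ * ∑ m ∈ F.erase n, |ψ n (y m)| := by rw [Finset.mul_sum]
        _ ≤ ‖c‖ * (δ / 2) := by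
          gcongr
          exact hoff n _ (Finset.notMem_erase n F)
      have h3 : |ψ n (∑ m ∈ F, c m • y m)| ≤ ‖∑ m ∈ F, c m • y m‖ := by
        refine ((ψ n).le_opNorm _).trans ?_
        exact mul_le_of_le_one_left (norm_nonneg _) (hψ n)
      have h4 : |c n| * δ ≤ |c n * ψ n (y n)| := by
        rw [abs_mul]
        gcongr
        exact (hdiag n).trans (le_abs_self _)
      rw [h1] at h3
      have h5 := abs_sub_abs_le_abs_sub (c n * ψ n (y n)) (-∑ m ∈ F.erase n, c m * ψ n (y m))
      rw [abs_neg, sub_neg_eq_add] at h5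
      linarith
    have hle : ‖c‖ ≤ (‖S c‖ + ‖c‖ * (δ / 2)) / δ := by
      conv_lhs => rw [← ZeroAtInftyContinuousMap.norm_toBCF_eq_norm]
      refine (BoundedContinuousFunction.norm_le (by positivity)).2 fun n => ?_
      rw [le_div_iff₀ hδ]
      have := hn n
      change |c n| * δ ≤ _
      linarith
    rw [le_div_iff₀ hδ] at hle
    linarith
  · refine le_of_tendsto (hS c).norm (Eventually.of_forall fun F => ?_)
    rw [mul_comm]
    exact norm_sum_smul_le h (norm_nonneg c) F fun n _ => habs c n

/-- **Bessaga-Pełczyński**: in a Banach space without copies of `c₀`, the terms of a weakly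
unconditionally Cauchy series tend to `0`. -/
theorem tendsto_zero_of_norm_sum_le [CompleteSpace E]
    (hE : ¬ ContainsCopy E (ZeroAtInftyContinuousMap ℕ ℝ)) {x : ℕ → E} {C : ℝ}
    (h : ∀ F : Finset ℕ, ∀ s : ℕ → ℝ, (∀ n, |s n| ≤ 1) → ‖∑ n ∈ F, s n • x n‖ ≤ C) :
    Tendsto x atTop (𝓝 0) := by
  by_contra hx
  refine hE ?_
  have hsum := sum_abs_dual_le h
  obtain ⟨δ, hδ, hS⟩ : ∃ δ > 0, {n | δ ≤ ‖x n‖}.Infinite := by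
    by_contra! hall
    refine hx (tendsto_zero_iff_norm_tendsto_zero.2 ?_)
    rw [← Nat.cofinite_eq_atTop, Metric.tendsto_nhds]
    intro δ hδ
    rw [eventually_cofinite]
    have := hall δ hδ
    simpa using this
  choose φ hφ hφx using fun n => exists_dual_vector'' ℝ (x n)
  obtain ⟨N, hN⟩ := exists_nat_ge (C / (δ / 2))
  rw [div_le_iff₀ (by positivity)] at hN
  -- Rosenthal's lemma makes the norming functionals of the terms of norm at least `δ` almost
  -- biorthogonal along a subsequence.
  obtain ⟨M, hMS, hM, hoff⟩ := exists_infinite_offDiag_sum_le (a := fun n m => |φ n (x m)|)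
    (half_pos hδ).le N hS fun n _ F _ => (hsum (φ n) (hφ n) F).trans hN
  let σ : ℕ ↪ ℕ := (hM.natEmbedding M).trans (Function.Embedding.subtype _)
  have hσ : ∀ n, σ n ∈ M := fun n => (hM.natEmbedding M n).2
  refine containsCopy_czero_of_biorthogonal (y := fun n => x (σ n)) (C := C) hδ
    (fun χ hχ F => ?_) (fun n => φ (σ n)) (fun n => hφ _) (fun n => ?_) fun n F hF => ?_
  · simpa using hsum χ hχ (F.map σ)
  · rw [hφx]
    exact hMS (hσ n)
  · have := hoff (σ n) (hσ n) (F.map σ) (by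
      rw [Finset.coe_map]
      rintro _ ⟨m, -, rfl⟩
      exact hσ m) (by simpa using hF)
    simpa using this

end CopiesOfCZero

/-! ### Peak functions with small images -/

section PeakFunctions

open Filter

/-- Choose points of `S` near an accumulation point `p`, with neighbourhoods whose closures avoid
`p`: finitely many such closures always leave room for the next choice. -/
theorem Set.Infinite.exists_seq_disjoint_isOpen {K : Type*} [TopologicalSpace K] [CompactSpace K]
    [T2Space K] {S U : Set K} (hS : S.Infinite) (hU : IsOpen U) (hSU : S ⊆ U) :
    ∃ (x : ℕ → K) (V : ℕ → Set K), (∀ n, x n ∈ S ∧ IsOpen (V n) ∧ x n ∈ V n ∧ V n ⊆ U) ∧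
      Pairwise (Function.onFun Disjoint V) := by
  obtain ⟨p, hp⟩ := hS.exists_accPt_principal
  rw [accPt_iff_nhds] at hp
  obtain ⟨g, hg, hdisj⟩ := exists_seq_of_forall_finset_exists
    (fun q : K × Set K => q.1 ∈ S ∧ IsOpen q.2 ∧ q.1 ∈ q.2 ∧ q.2 ⊆ U ∧ p ∉ closure q.2)
    (fun q q' => Disjoint q.2 q'.2) (by
      intro s hs
      have hN : ⋂ q ∈ s, (closure q.2)ᶜ ∈ 𝓝 p := (Filter.biInter_finset_mem s).2 fun q hq =>
        isClosed_closure.isOpen_compl.mem_nhds (hs q hq).2.2.2.2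
      obtain ⟨x, ⟨hxN, hxS⟩, hxp⟩ := hp _ hN
      obtain ⟨A, A', hA, hA', hxA, hpA', hAA'⟩ := t2_separation hxp
      have hopen : IsOpen (⋂ q ∈ s, (closure q.2)ᶜ) :=
        isOpen_biInter_finset fun q _ => isClosed_closure.isOpen_compl
      refine ⟨(x, (⋂ q ∈ s, (closure q.2)ᶜ) ∩ U ∩ A), ⟨hxS, (hopen.inter hU).inter hA,
        ⟨⟨hxN, hSU hxS⟩, hxA⟩, fun y hy => hy.1.2, fun hpc => ?_⟩, fun q hq => ?_⟩
      · exact (hAA'.closure_left hA').le_bot ⟨closure_mono inter_subset_right hpc, hpA'⟩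
      · refine Set.disjoint_left.2 fun y hyq hy => ?_
        exact (mem_iInter₂.1 hy.1.1 q hq) (subset_closure hyq))
  refine ⟨fun n => (g n).1, fun n => (g n).2, fun n => ⟨(hg n).1, (hg n).2.1, (hg n).2.2.1,
    (hg n).2.2.2.1⟩, fun m n hmn => ?_⟩
  rcases hmn.lt_or_gt with h | h
  · exact hdisj _ _ h
  · exact (hdisj _ _ h).symm

variable {K₁ K₂ E₁ E₂ : Type*}
  [TopologicalSpace K₁] [CompactSpace K₁] [TopologicalSpace K₂] [CompactSpace K₂]
  [NormedAddCommGroup E₁] [NormedSpace ℝ E₁] [NormedAddCommGroup E₂] [NormedSpace ℝ E₂]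

/-- Otherwise some function peaking at `x` would stay below `1 / 2` on the whole Choquet boundary,
against the maximum principle. -/
theorem weakPeakPoints_subset_closure_choquetBoundary (H : Submodule ℝ C(K₁, E₁)) :
    weakPeakPoints H ⊆ closure (choquetBoundary H) := by
  intro x hx
  by_contra hcl
  obtain ⟨f, hf, hf01, hfx, hfU⟩ := hx _ (isClosed_closure.isOpen_compl.mem_nhds hcl) (1 / 2)
    (by norm_num) (by norm_num)
  obtain ⟨z, hz, hxz⟩ := exists_extreme_evalOn (scalarSpace H) ⟨f, hf.1⟩ x
  have hz' : f z < 1 / 2 := hfU z ⟨hz, fun h => h (subset_closure hz)⟩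
  change f x ≤ |f z| at hxz
  rw [abs_of_nonneg (hf01 z).1] at hxz
  linarith

/-- The function `f ⊗ e` as a member of `H`, linearly in `e`. -/
noncomputable def tensorMem {H : Submodule ℝ C(K₁, E₁)} {f : C(K₁, ℝ)}
    (hf : f ∈ tensorMultipliers H) : E₁ →ₗ[ℝ] H where
  toFun e := ⟨tensorVec f e, hf.2 e⟩
  map_add' e e' := by
    ext x
    exact smul_add (f x) e e'
  map_smul' r e := by
    ext x
    exact smul_comm (f x) r e

theorem tensorMem_apply {H : Submodule ℝ C(K₁, E₁)} {f : C(K₁, ℝ)}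
    (hf : f ∈ tensorMultipliers H) (e : E₁) (x : K₁) :
    (tensorMem hf e : C(K₁, E₁)) x = f x • e := rfl

theorem norm_tensorMem_sub_lt {H : Submodule ℝ C(K₁, E₁)} {f : C(K₁, ℝ)}
    (hf : f ∈ tensorMultipliers H) {e : E₁} (he : ‖e‖ = 1) {x : K₁} {δ : ℝ} (hfx : 1 - δ < f x)
    (hfx1 : f x ≤ 1) : ‖(tensorMem hf e : C(K₁, E₁)) x - e‖ < δ := by
  rw [tensorMem_apply, show f x • e - e = (f x - 1) • e by rw [sub_smul, one_smul],
    norm_smul, he, mul_one, Real.norm_eq_abs]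
  exact abs_lt.2 ⟨by linarith, by linarith⟩

theorem norm_tensorMem_le {H : Submodule ℝ C(K₁, E₁)} {f : C(K₁, ℝ)}
    (hf : f ∈ tensorMultipliers H) {e : E₁} (he : ‖e‖ = 1) (hf01 : ∀ y, 0 ≤ f y ∧ f y ≤ 1) :
    ‖tensorMem hf e‖ ≤ 1 := by
  refine (ContinuousMap.norm_le _ zero_le_one).2 fun z => ?_
  change ‖f z • e‖ ≤ _
  rw [norm_smul, he, mul_one, Real.norm_of_nonneg (hf01 z).1]
  exact (hf01 z).2

/-- Functions peaking in disjoint open sets have uniformly bounded signed sums, so at each point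
their images form a weakly unconditionally Cauchy series in `E₂`. The terms tend to zero, and a late
one is small on all of the finite set `D`. -/
theorem exists_peak_small [T2Space K₁] [CompleteSpace E₂] {H : Submodule ℝ C(K₁, E₁)}
    (hE₂ : ¬ ContainsCopy E₂ (ZeroAtInftyContinuousMap ℕ ℝ)) (R : H →L[ℝ] C(K₂, E₂))
    {S U : Set K₁} (hS : S.Infinite) (hSW : S ⊆ weakPeakPoints H) (hU : IsOpen U) (hSU : S ⊆ U)
    {e : E₁} (he : ‖e‖ = 1) {D : Set K₂} (hD : D.Finite) {δ ε : ℝ} (hδ : 0 < δ) (hδ1 : δ < 1)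
    (hε : 0 < ε) :
    ∃ x ∈ S, ∃ (f : C(K₁, ℝ)) (hf : f ∈ tensorMultipliers H), (∀ y, 0 ≤ f y ∧ f y ≤ 1) ∧
      1 - δ < f x ∧ (∀ y ∈ choquetBoundary H \ U, f y < δ) ∧
      ∀ y ∈ D, ‖R (tensorMem hf e) y‖ < ε := by
  obtain ⟨x, V, hxV, hV⟩ := hS.exists_seq_disjoint_isOpen hU hSU
  have hpow : ∀ n : ℕ, δ * (1 / 2) ^ n ≤ δ := fun n =>
    mul_le_of_le_one_right hδ.le (pow_le_one₀ (by norm_num) (by norm_num))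
  -- The tolerances are summable, so a sum of these functions is at most `1 + 2δ` on the Choquet
  -- boundary, where at most one of them is at its peak.
  choose f hf hf01 hfx hfV using fun n =>
    hSW (hxV n).1 (V n) ((hxV n).2.1.mem_nhds (hxV n).2.2.1) (δ * (1 / 2) ^ n) (by positivity)
      ((hpow n).trans_lt hδ1)
  have hsum : ∀ F : Finset ℕ, ∀ z ∈ choquetBoundary H, ∑ n ∈ F, f n z ≤ 3 := by
    intro F z hz
    obtain ⟨m, hm⟩ : ∃ m, ∀ n ≠ m, z ∉ V n := by
      by_cases h : ∃ m, z ∈ V m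
      · obtain ⟨m, hm⟩ := h
        exact ⟨m, fun n hn hzn => (hV hn).le_bot ⟨hzn, hm⟩⟩
      · push Not at h
        exact ⟨0, fun n _ => h n⟩
    have hle : ∀ n, f n z ≤ (if n = m then 1 else 0) + δ * (1 / 2) ^ n := fun n => by
      split_ifs with hn
      · have : 0 ≤ δ * (1 / 2 : ℝ) ^ n := by positivity
        linarith [(hf01 n z).2]
      · rw [zero_add]
        exact (hfV n z ⟨hz, hm n hn⟩).le
    calc ∑ n ∈ F, f n z ≤ ∑ n ∈ F, ((if n = m then 1 else 0) + δ * (1 / 2) ^ n) :=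
          Finset.sum_le_sum fun n _ => hle n
      _ = (∑ n ∈ F, if n = m then 1 else 0) + δ * ∑ n ∈ F, (1 / 2 : ℝ) ^ n := by
          rw [Finset.sum_add_distrib, Finset.mul_sum]
      _ ≤ 1 + 1 * 2 := by
          gcongr
          · rw [Finset.sum_ite_eq']
            split_ifs <;> norm_num
          · exact (summable_geometric_two.sum_le_tsum F fun n _ => by positivity).trans_eq
              tsum_geometric_two
      _ = 3 := by norm_num
  have hbound : ∀ F : Finset ℕ, ∀ s : ℕ → ℝ, (∀ n, |s n| ≤ 1) →
      ‖∑ n ∈ F, s n • tensorMem (hf n) e‖ ≤ 3 := by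
    intro F s hs
    refine norm_le_of_forall_choquetBoundary _ (by norm_num) fun z hz => ?_
    have : ((∑ n ∈ F, s n • tensorMem (hf n) e : H) : C(K₁, E₁)) z = ∑ n ∈ F, s n • f n z • e := by
      simp [tensorMem_apply]
    rw [this]
    refine (norm_sum_le _ _).trans ((Finset.sum_le_sum fun n _ => ?_).trans (hsum F z hz))
    rw [norm_smul, norm_smul, he, mul_one, Real.norm_eq_abs, Real.norm_of_nonneg (hf01 n z).1]
    exact mul_le_of_le_one_left (hf01 n z).1 (hs n)
  have htend : ∀ y, Tendsto (fun n => R (tensorMem (hf n) e) y) atTop (𝓝 0) := fun y => by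
    refine tendsto_zero_of_norm_sum_le hE₂ (C := ‖R‖ * 3) fun F s hs => ?_
    calc ‖∑ n ∈ F, s n • R (tensorMem (hf n) e) y‖
        = ‖R (∑ n ∈ F, s n • tensorMem (hf n) e) y‖ := by simp [map_sum]
      _ ≤ ‖R (∑ n ∈ F, s n • tensorMem (hf n) e)‖ := ContinuousMap.norm_coe_le_norm _ y
      _ ≤ ‖R‖ * ‖∑ n ∈ F, s n • tensorMem (hf n) e‖ := R.le_opNorm _
      _ ≤ ‖R‖ * 3 := by gcongr; exact hbound F s hs
  have hev : ∀ᶠ n in atTop, ∀ y ∈ D, ‖R (tensorMem (hf n) e) y‖ < ε := by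
    rw [eventually_all_finite hD]
    intro y _
    have := (htend y).norm
    rw [norm_zero] at this
    exact this.eventually_lt_const hε
  obtain ⟨n, hn⟩ := hev.exists
  exact ⟨x n, (hxV n).1, f n, hf n, hf01 n, by linarith [hfx n, hpow n],
    fun y hy => (hfV n y ⟨hy.1, fun h => hy.2 ((hxV n).2.2.2 h)⟩).trans_le (hpow n), hn⟩

/-- If `E₂ᵐ` contains no copy of `E₁ⁿ`, then a combination of functions peaking at `n` given weak
peak points can be chosen to have an image that is small at `m` given points. -/
theorem exists_finite_peak_small [T2Space K₁] {H : Submodule ℝ C(K₁, E₁)}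
    (R : H →L[ℝ] C(K₂, E₂)) {W : Set K₁} {D : Set K₂} (hW : W.Finite)
    (hWH : W ⊆ weakPeakPoints H) (hD : D.Finite)
    (hno : ¬ ContainsCopy (Fin D.ncard → E₂) (Fin W.ncard → E₁)) {δ ε : ℝ} (hδ : 0 < δ)
    (hδ1 : δ < 1) (hε : 0 < ε) :
    ∃ e : E₁, ‖e‖ = 1 ∧ ∃ x ∈ W, ∃ h : H, ‖(h : C(K₁, E₁)) x - e‖ < δ ∧ ‖h‖ ≤ 1 + δ ∧
      ∀ y ∈ D, ‖R h y‖ < ε := by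
  have := hW.to_subtype
  have := hD.to_subtype
  let ι : W ≃ Fin W.ncard := Finite.equivFinOfCardEq (Nat.card_coe_set_eq W)
  let κ : D ≃ Fin D.ncard := Finite.equivFinOfCardEq (Nat.card_coe_set_eq D)
  obtain ⟨V, hV, hVdisj⟩ := hW.t2_separation
  set N := W.ncard
  let w : Fin N → K₁ := fun i => (ι.symm i : K₁)
  have hw : ∀ i, w i ∈ W := fun i => (ι.symm i).2
  have hwinj : Function.Injective w := Subtype.val_injective.comp ι.symm.injective
  have hη : 0 < δ / (N + 1) := by positivity
  have hη1 : δ / (N + 1) < 1 := (div_le_self hδ.le (by simp)).trans_lt hδ1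
  have hNη : N * (δ / (N + 1)) < δ := by
    rw [← mul_div_assoc, div_lt_iff₀ (by positivity)]
    nlinarith
  set η := δ / (N + 1)
  choose f hf hf01 hfx hfV using fun i =>
    hWH (hw i) (V (w i)) ((hV (w i)).2.mem_nhds (hV (w i)).1) η hη hη1
  have hdisj : ∀ i j, i ≠ j → Disjoint (V (w i)) (V (w j)) := fun i j hij =>
    hVdisj (hw i) (hw j) (hwinj.ne hij)
  let u : (Fin N → E₁) →ₗ[ℝ] H := ∑ i, (tensorMem (hf i)).comp (LinearMap.proj i)
  have hu : ∀ c z, (u c : C(K₁, E₁)) z = ∑ i, f i z • c i := fun c z => by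
    simp [u, tensorMem_apply]
  have hun : ∀ c, ‖u c‖ ≤ (1 + δ) * ‖c‖ := fun c => by
    refine norm_le_of_forall_choquetBoundary _ (by positivity) fun z hz => ?_
    rw [hu]
    have hle : ∑ i, f i z ≤ 1 + N * η := by
      by_cases h : ∃ m, z ∈ V (w m)
      · obtain ⟨m, hm⟩ := h
        calc ∑ i, f i z ≤ ∑ i, ((if i = m then 1 else 0) + η) := Finset.sum_le_sum fun i _ => by
              split_ifs with hi
              · linarith [(hf01 i z).2]
              · rw [zero_add]
                exact (hfV i z ⟨hz, fun hzi => (hdisj i m hi).le_bot ⟨hzi, hm⟩⟩).le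
          _ = 1 + N * η := by simp [Finset.sum_add_distrib]
      · push Not at h
        calc ∑ i, f i z ≤ ∑ _i : Fin N, η := Finset.sum_le_sum fun i _ => (hfV i z ⟨hz, h i⟩).le
          _ ≤ 1 + N * η := by simp
    calc ‖∑ i, f i z • c i‖ ≤ ∑ i, f i z * ‖c‖ := by
          refine (norm_sum_le _ _).trans (Finset.sum_le_sum fun i _ => ?_)
          rw [norm_smul, Real.norm_of_nonneg (hf01 i z).1]
          exact mul_le_mul_of_nonneg_left (norm_le_pi_norm c i) (hf01 i z).1
      _ = (∑ i, f i z) * ‖c‖ := by rw [Finset.sum_mul]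
      _ ≤ (1 + δ) * ‖c‖ := by gcongr; linarith
  -- Peak functions are controlled only on the Choquet boundary; the bound passes to `w i` because
  -- `w i` lies in its closure.
  have hoff : ∀ i j, j ≠ i → f j (w i) ≤ η := fun i j hji => by
    have hmem : w i ∈ closure (V (w i) ∩ choquetBoundary H) :=
      (hV (w i)).2.inter_closure
        ⟨(hV (w i)).1, weakPeakPoints_subset_closure_choquetBoundary H (hWH (hw i))⟩
    refine closure_minimal (t := {z | f j z ≤ η}) ?_
      (isClosed_le (f j).continuous continuous_const) hmem
    rintro z ⟨hzV, hz⟩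
    exact (hfV j z ⟨hz, fun hzj => (hdisj j i hji).le_bot ⟨hzj, hzV⟩⟩).le
  have hnear : ∀ c i, ‖c‖ ≤ 1 → ‖(u c : C(K₁, E₁)) (w i) - c i‖ < δ := fun c i hc => by
    have hci : ∀ j, ‖c j‖ ≤ 1 := fun j => (norm_le_pi_norm c j).trans hc
    refine lt_of_le_of_lt ?_ hNη
    have : (u c : C(K₁, E₁)) (w i) - c i = ∑ j, (f j (w i) - if j = i then 1 else 0) • c j := by
      rw [hu]
      simp [sub_smul, Finset.sum_sub_distrib]
    rw [this]
    calc ‖∑ j, (f j (w i) - if j = i then 1 else 0) • c j‖ ≤ ∑ _j : Fin N, η := by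
          refine (norm_sum_le _ _).trans (Finset.sum_le_sum fun j _ => ?_)
          rw [norm_smul, Real.norm_eq_abs]
          refine (mul_le_of_le_one_right (abs_nonneg _) (hci j)).trans ?_
          split_ifs with hj
          · subst hj
            exact abs_le.2 ⟨by linarith [hfx j], by linarith [(hf01 j (w j)).2]⟩
          · rw [sub_zero, abs_of_nonneg (hf01 j _).1]
            exact hoff i j hj
      _ = N * η := by simp
  let S : (Fin N → E₁) →ₗ[ℝ] (Fin D.ncard → E₂) := LinearMap.pi fun q =>
    (ContinuousMap.evalCLM ℝ (κ.symm q : K₂) : C(K₂, E₂) →L[ℝ] E₂).toLinearMap.comp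
      (R.toLinearMap.comp u)
  have hS : ∀ c q, S c q = R (u c) (κ.symm q) := fun c q => rfl
  -- Otherwise `S` would be bounded below and embed the forbidden copy.
  obtain ⟨c, hc⟩ : ∃ c, ‖S c‖ < ε * ‖c‖ := by
    by_contra! hall
    refine hno (containsCopy_of_bounded_below S hε hall (C := ‖R‖ * (1 + δ)) fun c => ?_)
    refine (pi_norm_le_iff_of_nonneg (by positivity)).2 fun q => ?_
    calc ‖R (u c) (κ.symm q)‖ ≤ ‖R (u c)‖ := ContinuousMap.norm_coe_le_norm _ _
      _ ≤ ‖R‖ * ‖u c‖ := R.le_opNorm _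
      _ ≤ ‖R‖ * ((1 + δ) * ‖c‖) := by gcongr; exact hun c
      _ = ‖R‖ * (1 + δ) * ‖c‖ := by ring
  have hc0 : 0 < ‖c‖ := by
    by_contra h
    have : ‖c‖ = 0 := le_antisymm (not_lt.1 h) (norm_nonneg c)
    rw [this, mul_zero] at hc
    exact absurd hc (norm_nonneg _).not_gt
  set v := ‖c‖⁻¹ • c with hv
  have hvn : ‖v‖ = 1 := by rw [hv, norm_smul, norm_inv, norm_norm, inv_mul_cancel₀ hc0.ne']
  have hSv : ‖S v‖ < ε := by
    rw [hv, map_smul, norm_smul, norm_inv, norm_norm, inv_mul_lt_iff₀ hc0, mul_comm]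
    exact hc
  obtain ⟨i, hi⟩ : ∃ i, ‖v i‖ = 1 := by
    by_contra! hne
    have : ‖v‖ < 1 := (pi_norm_lt_iff zero_lt_one).2 fun i =>
      lt_of_le_of_ne ((norm_le_pi_norm v i).trans hvn.le) (hne i)
    exact absurd hvn this.ne
  refine ⟨v i, hi, w i, hw i, u v, hnear v i hvn.le, by simpa [hvn] using hun v, fun y hy => ?_⟩
  have := (norm_le_pi_norm (S v) (κ ⟨y, hy⟩)).trans_lt hSv
  rwa [hS, Equiv.symm_apply_apply] at this

end PeakFunctions

/-! ### Nested chains of peak functions -/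

section PeakChains

open Filter CantorBendixson

variable {X Y : Type*} [TopologicalSpace X] [NormedAddCommGroup Y]

open scoped Classical in
/-- The number of the functions `g 0, …, g s` whose norm at `y` is at least `ε`. -/
noncomputable def countLarge (ε : ℝ) (s : ℕ) (g : ℕ → C(X, Y)) (y : X) : ℕ :=
  ((Finset.range (s + 1)).filter fun i => ε ≤ ‖g i y‖).card

theorem eventually_countLarge_le (ε : ℝ) (s : ℕ) (g : ℕ → C(X, Y)) (y : X) :
    ∀ᶠ z in 𝓝 y, countLarge ε s g z ≤ countLarge ε s g y := by
  classical
  have : ∀ᶠ z in 𝓝 y, ∀ i ∈ Finset.range (s + 1), ‖g i y‖ < ε → ‖g i z‖ < ε := by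
    rw [eventually_all_finset]
    intro i _
    by_cases h : ‖g i y‖ < ε
    · exact ((g i).continuous.norm.continuousAt.eventually_lt_const h).mono fun z hz _ => hz
    · exact Eventually.of_forall fun z h' => absurd h' h
  filter_upwards [this] with z hz
  refine Finset.card_le_card fun i hi => ?_
  rw [Finset.mem_filter] at hi ⊢
  exact ⟨hi.1, not_lt.1 fun h => absurd hi.2 (hz i hi.1 h).not_ge⟩

theorem countLarge_succ (ε : ℝ) (s : ℕ) (g : ℕ → C(X, Y)) (y : X) [Decidable (ε ≤ ‖g (s + 1) y‖)] :
    countLarge ε (s + 1) g y =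
      countLarge ε s g y + if ε ≤ ‖g (s + 1) y‖ then 1 else 0 := by
  classical
  unfold countLarge
  rw [Finset.range_add_one (n := s + 1), Finset.filter_insert]
  split_ifs with h
  · rw [Finset.card_insert_of_notMem (by simp)]
  · rfl

theorem countLarge_congr {ε : ℝ} {s : ℕ} {g g' : ℕ → C(X, Y)} {y : X}
    (h : ∀ i ≤ s, g i = g' i) : countLarge ε s g y = countLarge ε s g' y := by
  classical
  unfold countLarge
  congr 1
  refine Finset.filter_congr fun i hi => ?_
  rw [h i (Nat.lt_succ_iff.1 (Finset.mem_range.1 hi))]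

theorem iteratedDerivedSet_natCast_succ (S : Set X) (r : ℕ) :
    iteratedDerivedSet S ((r + 1 : ℕ) : Ordinal) =
      derivedSet (iteratedDerivedSet S (r : Ordinal)) ∩ iteratedDerivedSet S (r : Ordinal) := by
  rw [Nat.cast_succ, iteratedDerivedSet_succ, relDerivedSet_apply]

theorem iteratedDerivedSet_natCast_subset (S : Set X) (r : ℕ) :
    iteratedDerivedSet S (r : Ordinal) ⊆ S := by
  have := iteratedDerivedSet_antitone S (show (0 : Ordinal) ≤ r from zero_le)
  rwa [iteratedDerivedSet_zero] at this

variable {K₁ K₂ E₁ E₂ : Type*}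
  [TopologicalSpace K₁] [CompactSpace K₁] [TopologicalSpace K₂] [CompactSpace K₂]
  [NormedAddCommGroup E₁] [NormedSpace ℝ E₁] [NormedAddCommGroup E₂] [NormedSpace ℝ E₂]

/-- Functions `h 0, …, h s` in `H` which are nearly equal to the constant `e` at `x` and nearly
nested, such that only few of their images under `R` are large at a given point of the boundary. -/
structure IsPeakChain {H : Submodule ℝ C(K₁, E₁)} (R : H → C(K₂, E₂)) (B : Set K₂) (k : ℕ)
    (δ ε : ℝ) (e : E₁) (s : ℕ) (h : ℕ → H) (x : K₁) : Prop where
  near : ∀ i ≤ s, ‖(h i : C(K₁, E₁)) x - e‖ < δ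
  norm_le : ∀ i ≤ s, ‖h i‖ ≤ 1 + δ
  nested : ∀ i j, i < j → j ≤ s → ∀ z ∈ choquetBoundary H, ‖(h j : C(K₁, E₁)) z‖ ≤ δ ∨
    (‖(h i : C(K₁, E₁)) z - e‖ ≤ δ ∧ ∃ t : ℝ, 0 ≤ t ∧ t ≤ 1 ∧ (h j : C(K₁, E₁)) z = t • e)
  -- Each derivative of `B` lowers the allowance by one; this slack is what makes the saturated
  -- points finite in number.
  count : ∀ j ≤ k, ∀ y ∈ iteratedDerivedSet B (j : Ordinal),
    countLarge ε s (fun i => R (h i)) y + j ≤ k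

variable {H : Submodule ℝ C(K₁, E₁)} {R : H →L[ℝ] C(K₂, E₂)} {B : Set K₂} {k s : ℕ} {δ ε : ℝ}
  {e : E₁} {h : ℕ → H} {x : K₁}

theorem IsPeakChain.zero {h₀ : H} {H₂ : Submodule ℝ C(K₂, E₂)} (hR : ∀ u, R u ∈ H₂) (hε : 0 < ε)
    (hx : ‖(h₀ : C(K₁, E₁)) x - e‖ < δ) (hn : ‖h₀‖ ≤ 1 + δ)
    (hsmall : ∀ y ∈ iteratedDerivedSet B (k : Ordinal) ∩ nonvanishingSet H₂, ‖R h₀ y‖ < ε) :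
    IsPeakChain R B k δ ε e 0 (fun _ => h₀) x where
  near _ _ := hx
  norm_le _ _ := hn
  nested i j hij hj := by omega
  count j hj y hy := by
    classical
    rcases hj.eq_or_lt with rfl | hlt
    · have : countLarge ε 0 (fun _ => R h₀) y = 0 := by
        unfold countLarge
        rw [Finset.card_eq_zero, Finset.filter_eq_empty_iff]
        intro _ _ hle
        refine absurd hle (hsmall y ⟨hy, R h₀, hR h₀, fun h0 => ?_⟩).not_ge
        rw [h0, norm_zero] at hle
        exact absurd hle hε.not_ge
      omega
    · have : countLarge ε 0 (fun _ => R h₀) y ≤ 1 := by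
        unfold countLarge
        exact (Finset.card_filter_le _ _).trans (by simp)
      omega

/-- An accumulation point of saturated points would lie in the derivative of order `j + 1`, where
the count is smaller by one, whereas the count cannot jump up at nearby points. -/
theorem IsPeakChain.finite_setOf_count (hc : IsPeakChain R B k δ ε e s h x) (hB : IsClosed B)
    {Ω : Set K₂} (hD : (iteratedDerivedSet B (k : Ordinal) ∩ Ω).Finite) {j : ℕ} (hj : j ≤ k) :
    {y | y ∈ iteratedDerivedSet B (j : Ordinal) ∩ Ω ∧
      k ≤ countLarge ε s (fun i => R (h i)) y + j}.Finite := by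
  rcases hj.eq_or_lt with rfl | hlt
  · exact hD.subset fun y hy => hy.1
  by_contra hinf
  obtain ⟨p, hp⟩ := Set.Infinite.exists_accPt_principal hinf
  have hpd : p ∈ derivedSet (iteratedDerivedSet B (j : Ordinal)) :=
    derivedSet_mono _ _ (fun y hy => hy.1.1) hp
  have hpB : p ∈ iteratedDerivedSet B ((j + 1 : ℕ) : Ordinal) := by
    rw [iteratedDerivedSet_natCast_succ]
    exact ⟨hpd, (isClosed_iff_derivedSet_subset _).1 (isClosed_iteratedDerivedSet hB _) hpd⟩
  have hcount := hc.count (j + 1) hlt p hpB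
  obtain ⟨y, ⟨-, hy⟩, hyp⟩ := ((accPt_iff_frequently.1 hp).and_eventually
    (eventually_countLarge_le ε s (fun i => R (h i)) p)).exists
  have := hy.2
  omega

theorem IsPeakChain.succ [T2Space K₁] [CompleteSpace E₂]
    (hE₂ : ¬ ContainsCopy E₂ (ZeroAtInftyContinuousMap ℕ ℝ))
    {H₂ : Submodule ℝ C(K₂, E₂)} (hR : ∀ u, R u ∈ H₂) (hB : IsClosed B)
    (hD : (iteratedDerivedSet B (k : Ordinal) ∩ nonvanishingSet H₂).Finite)
    (he : ‖e‖ = 1) (hδ : 0 < δ) (hδ1 : δ < 1) (hε : 0 < ε)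
    (hc : IsPeakChain R B k δ ε e s h x) {r : ℕ}
    (hx : x ∈ iteratedDerivedSet (weakPeakPoints H) ((r + 1 : ℕ) : Ordinal)) :
    ∃ h' : ℕ → H, ∃ x' ∈ iteratedDerivedSet (weakPeakPoints H) (r : Ordinal),
      IsPeakChain R B k δ ε e (s + 1) h' x' := by
  classical
  -- The next function peaks inside `U`, where all earlier ones are close to `e`; this produces
  -- nestedness.
  set U : Set K₁ := ⋂ i ∈ Finset.range (s + 1), {z | ‖(h i : C(K₁, E₁)) z - e‖ < δ} with hUdef
  have hUmem : ∀ z, z ∈ U ↔ ∀ i ≤ s, ‖(h i : C(K₁, E₁)) z - e‖ < δ := fun z => by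
    simp [hUdef]
  have hU : IsOpen U := isOpen_biInter_finset fun i _ =>
    isOpen_lt (((h i : C(K₁, E₁)).continuous.sub continuous_const).norm) continuous_const
  have hxU : x ∈ U := (hUmem x).2 hc.near
  rw [iteratedDerivedSet_natCast_succ] at hx
  have hinf : (U ∩ iteratedDerivedSet (weakPeakPoints H) (r : Ordinal)).Infinite := by
    have : AccPt x (𝓟 (U ∩ iteratedDerivedSet (weakPeakPoints H) (r : Ordinal))) := by
      rw [accPt_iff_nhds]
      intro N hN
      obtain ⟨y, ⟨hyN, hyW⟩, hyx⟩ :=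
        (accPt_iff_nhds.1 hx.1) (N ∩ U) (inter_mem hN (hU.mem_nhds hxU))
      exact ⟨y, ⟨hyN.1, hyN.2, hyW⟩, hyx⟩
    exact Set.Infinite.of_accPt this
  -- All saturated points, for every order `j ≤ k`. Elsewhere in `B` the count has room for one more
  -- large image, or the images vanish.
  have hfin : (⋃ j ∈ Finset.range (k + 1), {y | y ∈ iteratedDerivedSet B (j : Ordinal) ∩
      nonvanishingSet H₂ ∧ k ≤ countLarge ε s (fun i => R (h i)) y + j}).Finite :=
    (Finset.range (k + 1)).finite_toSet.biUnion fun j hj => hc.finite_setOf_count hB hD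
      (Nat.lt_succ_iff.1 (Finset.mem_range.1 hj))
  obtain ⟨x', hx', f, hf, hf01, hfx, hfU, hsmall⟩ := exists_peak_small hE₂ R hinf
    (inter_subset_right.trans (iteratedDerivedSet_natCast_subset _ r)) hU inter_subset_left he hfin hδ hδ1 hε
  set h' : ℕ → H := Function.update h (s + 1) (tensorMem hf e) with hh'
  have hold : ∀ i ≤ s, h' i = h i := fun i hi => Function.update_of_ne (by omega) _ _
  have hnew : h' (s + 1) = tensorMem hf e := Function.update_self _ _ _
  have hlast : ∀ i ≤ s + 1, i ≤ s ∨ i = s + 1 := fun i hi => by omega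
  refine ⟨h', x', hx'.2, ⟨fun i hi => ?_, fun i hi => ?_, fun i j hij hj z hz => ?_,
    fun j hj y hy => ?_⟩⟩
  · rcases hlast i hi with hi | rfl
    · rw [hold i hi]
      exact (hUmem x').1 hx'.1 i hi
    · rw [hnew]
      exact norm_tensorMem_sub_lt hf he hfx (hf01 x').2
  · rcases hlast i hi with hi | rfl
    · rw [hold i hi]
      exact hc.norm_le i hi
    · rw [hnew]
      linarith [norm_tensorMem_le hf he hf01]
  · rcases hlast j hj with hj | rfl
    · rw [hold i (by omega), hold j hj]
      exact hc.nested i j hij hj z hz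
    · rw [hold i (by omega), hnew, tensorMem_apply]
      by_cases hzU : z ∈ U
      · exact Or.inr ⟨((hUmem z).1 hzU i (by omega)).le, f z, (hf01 z).1, (hf01 z).2, rfl⟩
      · left
        rw [norm_smul, he, mul_one, Real.norm_of_nonneg (hf01 z).1]
        exact (hfU z ⟨hz, hzU⟩).le
  · rw [countLarge_succ, countLarge_congr (g' := fun i => R (h i)) fun i hi => by rw [hold i hi]]
    have hcount := hc.count j hj y hy
    split_ifs with hle
    · rw [hnew] at hle
      by_contra hlt
      refine absurd hle (hsmall y (mem_biUnion (Finset.mem_range.2 (Nat.lt_succ_of_le hj))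
        ⟨⟨hy, R (tensorMem hf e), hR _, fun h0 => ?_⟩, by omega⟩)).not_ge
      rw [h0, norm_zero] at hle
      exact absurd hle hε.not_ge
    · omega

theorem IsPeakChain.exists_chain [T2Space K₁] [CompleteSpace E₂]
    (hE₂ : ¬ ContainsCopy E₂ (ZeroAtInftyContinuousMap ℕ ℝ))
    {H₂ : Submodule ℝ C(K₂, E₂)} (hR : ∀ u, R u ∈ H₂) (hB : IsClosed B)
    (hD : (iteratedDerivedSet B (k : Ordinal) ∩ nonvanishingSet H₂).Finite)
    (he : ‖e‖ = 1) (hδ : 0 < δ) (hδ1 : δ < 1) (hε : 0 < ε)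
    (hc : IsPeakChain R B k δ ε e s h x) {r : ℕ}
    (hx : x ∈ iteratedDerivedSet (weakPeakPoints H) (r : Ordinal)) :
    ∃ h' : ℕ → H, ∃ x', IsPeakChain R B k δ ε e (s + r) h' x' := by
  induction r generalizing s h x with
  | zero => exact ⟨h, x, hc⟩
  | succ r ih =>
    obtain ⟨h', x', hx', hc'⟩ := hc.succ hE₂ hR hB hD he hδ hδ1 hε hx
    obtain ⟨h'', x'', hc''⟩ := ih hc' hx'
    exact ⟨h'', x'', by rwa [show s + (r + 1) = s + 1 + r by omega]⟩

/-- Either `h j` is negligible and `h i` remains, or the value is close to `(2 * t - 1) • e` with `0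
≤ t ≤ 1`. -/
theorem IsPeakChain.norm_two_smul_sub_le (hc : IsPeakChain R B k δ ε e s h x) (he : ‖e‖ = 1)
    (hδ : 0 ≤ δ) {i j : ℕ} (hij : i < j) (hj : j ≤ s) :
    ‖(2 : ℝ) • h j - h i‖ ≤ 1 + 3 * δ := by
  refine norm_le_of_forall_choquetBoundary _ (by positivity) fun z hz => ?_
  change ‖(2 : ℝ) • (h j : C(K₁, E₁)) z - (h i : C(K₁, E₁)) z‖ ≤ _
  rcases hc.nested i j hij hj z hz with hs | ⟨hi, t, ht0, ht1, ht⟩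
  · have h1 := norm_sub_le ((2 : ℝ) • (h j : C(K₁, E₁)) z) ((h i : C(K₁, E₁)) z)
    have h2 := ((h i : C(K₁, E₁)).norm_coe_le_norm z).trans (hc.norm_le i (by omega))
    rw [norm_smul, Real.norm_ofNat] at h1
    linarith
  · have h1 : (2 : ℝ) • (h j : C(K₁, E₁)) z - (h i : C(K₁, E₁)) z =
        (2 * t - 1) • e - ((h i : C(K₁, E₁)) z - e) := by
      rw [ht]
      module
    have h2 : ‖(2 * t - 1) • e‖ ≤ 1 := by
      rw [norm_smul, he, mul_one, Real.norm_eq_abs]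
      exact abs_le.2 ⟨by linarith, by linarith⟩
    rw [h1]
    linarith [norm_sub_le ((2 * t - 1) • e) ((h i : C(K₁, E₁)) z - e)]

/-- Where `h s` is negligible the preceding bound applies to `2 h i - h 0`; elsewhere `h 0` and `h
i` are both close to `e`, and again `(2 * t - 1) • e` is left. -/
theorem IsPeakChain.norm_alternating_le (hc : IsPeakChain R B k δ ε e s h x) (he : ‖e‖ = 1)
    (hδ : 0 ≤ δ) {i : ℕ} (hi0 : 0 < i) (his : i < s) :
    ‖(2 : ℝ) • h s - ((2 : ℝ) • h i - h 0)‖ ≤ 1 + 5 * δ := by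
  refine norm_le_of_forall_choquetBoundary _ (by positivity) fun z hz => ?_
  change ‖(2 : ℝ) • (h s : C(K₁, E₁)) z -
    ((2 : ℝ) • (h i : C(K₁, E₁)) z - (h 0 : C(K₁, E₁)) z)‖ ≤ _
  have hsmall : ‖(h s : C(K₁, E₁)) z‖ ≤ δ → ‖(2 : ℝ) • (h s : C(K₁, E₁)) z -
      ((2 : ℝ) • (h i : C(K₁, E₁)) z - (h 0 : C(K₁, E₁)) z)‖ ≤ 1 + 5 * δ := fun hs => by
    have h1 := norm_sub_le ((2 : ℝ) • (h s : C(K₁, E₁)) z)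
      ((2 : ℝ) • (h i : C(K₁, E₁)) z - (h 0 : C(K₁, E₁)) z)
    have h2 : ‖(2 : ℝ) • (h i : C(K₁, E₁)) z - (h 0 : C(K₁, E₁)) z‖ ≤ 1 + 3 * δ :=
      (((2 : ℝ) • h i - h 0 : H) : C(K₁, E₁)).norm_coe_le_norm z |>.trans
        (hc.norm_two_smul_sub_le he hδ hi0 his.le)
    rw [norm_smul, Real.norm_ofNat] at h1
    linarith
  rcases hc.nested 0 s (by omega) le_rfl z hz with hs | ⟨h0, t, ht0, ht1, ht⟩
  · exact hsmall hs
  rcases hc.nested i s his le_rfl z hz with hs | ⟨hi, -⟩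
  · exact hsmall hs
  have h1 : (2 : ℝ) • (h s : C(K₁, E₁)) z -
      ((2 : ℝ) • (h i : C(K₁, E₁)) z - (h 0 : C(K₁, E₁)) z) =
      (2 * t - 1) • e - ((2 : ℝ) • ((h i : C(K₁, E₁)) z - e) - ((h 0 : C(K₁, E₁)) z - e)) := by
    rw [ht]
    module
  have h2 : ‖(2 * t - 1) • e‖ ≤ 1 := by
    rw [norm_smul, he, mul_one, Real.norm_eq_abs]
    exact abs_le.2 ⟨by linarith, by linarith⟩
  have h3 := norm_sub_le ((2 * t - 1) • e)
    ((2 : ℝ) • ((h i : C(K₁, E₁)) z - e) - ((h 0 : C(K₁, E₁)) z - e))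
  have h4 := norm_sub_le ((2 : ℝ) • ((h i : C(K₁, E₁)) z - e)) ((h 0 : C(K₁, E₁)) z - e)
  rw [norm_smul, Real.norm_ofNat] at h4
  rw [h1]
  linarith

end PeakChains

/-! ### Lower bounds for the distortion -/

section Distortion

open Filter CantorBendixson

variable {K₁ K₂ E₁ E₂ : Type*}
  [TopologicalSpace K₁] [CompactSpace K₁] [TopologicalSpace K₂] [CompactSpace K₂]
  [NormedAddCommGroup E₁] [NormedSpace ℝ E₁] [NormedAddCommGroup E₂] [NormedSpace ℝ E₂]
  {H : Submodule ℝ C(K₁, E₁)} {R : H →L[ℝ] C(K₂, E₂)} {B : Set K₂} {k l : ℕ} {δ ε a b : ℝ}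
  {e : E₁} {h : ℕ → H} {x : K₁}

theorem IsPeakChain.exists_small (hc : IsPeakChain R B k δ ε e l h x) {y : K₂} (hy : y ∈ B)
    {i : ℕ} (hki : k ≤ i) (hil : i ≤ l) : ∃ j ≤ i, ‖R (h j) y‖ < ε := by
  classical
  by_contra! hall
  have hcount := hc.count 0 (Nat.zero_le k) y (by simpa using hy)
  have : (Finset.range (i + 1)).card ≤ countLarge ε l (fun i => R (h i)) y := by
    refine Finset.card_le_card fun j hj => ?_
    rw [Finset.mem_range] at hj
    exact Finset.mem_filter.2 ⟨Finset.mem_range.2 (by omega), hall j (by omega)⟩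
  rw [Finset.card_range] at this
  omega

theorem IsPeakChain.le_norm_sum (hc : IsPeakChain R B k δ ε e l h x) (he : ‖e‖ = 1) {w : ℕ → ℝ}
    (hw : ∀ i, 0 ≤ w i) :
    (∑ i ∈ Finset.range (l + 1), w i) * (1 - δ) ≤ ‖∑ i ∈ Finset.range (l + 1), w i • h i‖ := by
  have h1 : ((∑ i ∈ Finset.range (l + 1), w i • h i : H) : C(K₁, E₁)) x =
      (∑ i ∈ Finset.range (l + 1), w i) • e +
        ∑ i ∈ Finset.range (l + 1), w i • ((h i : C(K₁, E₁)) x - e) := by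
    simp [smul_sub, Finset.sum_sub_distrib, Finset.sum_smul]
  have h2 : ‖∑ i ∈ Finset.range (l + 1), w i • ((h i : C(K₁, E₁)) x - e)‖ ≤
      (∑ i ∈ Finset.range (l + 1), w i) * δ := by
    rw [Finset.sum_mul]
    refine (norm_sum_le _ _).trans (Finset.sum_le_sum fun i hi => ?_)
    rw [norm_smul, Real.norm_of_nonneg (hw i)]
    exact mul_le_mul_of_nonneg_left
      (hc.near i (Nat.lt_succ_iff.1 (Finset.mem_range.1 hi))).le (hw i)
  have h3 : ‖(∑ i ∈ Finset.range (l + 1), w i) • e‖ = ∑ i ∈ Finset.range (l + 1), w i := by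
    rw [norm_smul, he, mul_one, Real.norm_of_nonneg (Finset.sum_nonneg fun i _ => hw i)]
  have h4 := norm_sub_le_norm_add ((∑ i ∈ Finset.range (l + 1), w i) • e)
    (∑ i ∈ Finset.range (l + 1), w i • ((h i : C(K₁, E₁)) x - e))
  rw [← h1, h3] at h4
  have h5 := ((∑ i ∈ Finset.range (l + 1), w i • h i : H) : C(K₁, E₁)).norm_coe_le_norm x
  change _ ≤ ‖∑ i ∈ Finset.range (l + 1), w i • h i‖ at h5
  linarith

theorem sum_range_ite_one_two (hkl : k ≤ l) :
    ∑ i ∈ Finset.range (l + 1), (if i < k then (1 : ℝ) else 2) = 2 * l + 2 - k := by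
  have h1 : ∀ i, (if i < k then (1 : ℝ) else 2) = 2 - if i < k then 1 else 0 := fun i => by
    split_ifs <;> norm_num
  have h2 : (Finset.range (l + 1)).filter (· < k) = Finset.range k := by
    ext i
    simp only [Finset.mem_filter, Finset.mem_range]
    omega
  simp only [h1, Finset.sum_sub_distrib, Finset.sum_boole, h2]
  simp
  ring

theorem norm_apply_le_of_norm_le (hup : ∀ u, ‖R u‖ ≤ a * ‖u‖) (ha : 0 ≤ a) {u : H} {c : ℝ}
    (hu : ‖u‖ ≤ c) (y : K₂) : ‖R u y‖ ≤ a * c :=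
  (ContinuousMap.norm_coe_le_norm _ y).trans ((hup u).trans (mul_le_mul_of_nonneg_left hu ha))

/-- The weights are chosen so that each large image contributes about `a` at most, though the
weights total `2l + 2 - k`. Weight `2` is affordable from index `k` on because some earlier image is
then small. -/
theorem IsPeakChain.weighted_bound (hc : IsPeakChain R B k δ ε e l h x) (he : ‖e‖ = 1)
    (hδ : 0 ≤ δ) (hε : 0 ≤ ε) (hkl : k ≤ l) (ha : 0 ≤ a) (hb : 0 ≤ b)
    (hup : ∀ u, ‖R u‖ ≤ a * ‖u‖) (hlow : ∀ u, ‖u‖ ≤ b * ‖R u‖)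
    (hB : ∀ u c, 0 ≤ c → (∀ y ∈ B, ‖R u y‖ ≤ c) → ‖R u‖ ≤ c) :
    (2 * l + 2 - k) * (1 - δ) ≤ b * (k * (a * (1 + 3 * δ) + ε) + (l + 1) * (2 * ε)) := by
  classical
  set w : ℕ → ℝ := fun i => if i < k then 1 else 2 with hw
  have hw0 : ∀ i, 0 ≤ w i := fun i => by
    simp only [hw]
    split_ifs <;> norm_num
  have hw2 : ∀ i, w i ≤ 2 := fun i => by
    simp only [hw]
    split_ifs <;> norm_num
  have h1 := hc.le_norm_sum he hw0
  rw [sum_range_ite_one_two hkl] at h1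
  refine h1.trans ((hlow _).trans (mul_le_mul_of_nonneg_left ?_ hb))
  refine hB _ _ (by positivity) fun y hy => ?_
  have hcount := hc.count 0 (Nat.zero_le k) y (by simpa using hy)
  have hterm : ∀ i ∈ Finset.range (l + 1), w i * ‖R (h i) y‖ ≤
      (if ε ≤ ‖R (h i) y‖ then a * (1 + 3 * δ) + ε else 0) + 2 * ε := fun i hi => by
    have hil := Nat.lt_succ_iff.1 (Finset.mem_range.1 hi)
    split_ifs with hlarge
    · by_cases hik : i < k
      · have h2 := norm_apply_le_of_norm_le hup ha (hc.norm_le i hil) y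
        simp only [hw, if_pos hik, one_mul]
        nlinarith [mul_nonneg ha hδ]
      -- Subtracting `h j` costs less than `ε` at `y`, while `2 h i - h j` has norm close to `1`, so
      -- `2 ‖R (h i) y‖` is about `a` at most.
      · obtain ⟨j, hji, hj⟩ := hc.exists_small hy (not_lt.1 hik) hil
        have hji' : j < i := lt_of_le_of_ne hji fun h => by
          subst h
          exact absurd hlarge hj.not_ge
        have h2 := norm_apply_le_of_norm_le hup ha (hc.norm_two_smul_sub_le he hδ hji' hil) y
        rw [map_sub, map_smul, ContinuousMap.sub_apply, ContinuousMap.smul_apply] at h2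
        have h3 := norm_sub_norm_le ((2 : ℝ) • R (h i) y) (R (h j) y)
        rw [norm_smul, Real.norm_ofNat] at h3
        simp only [hw, if_neg hik]
        linarith
    · rw [zero_add]
      exact mul_le_mul (hw2 i) (not_le.1 hlarge).le (norm_nonneg _) zero_le_two
  calc ‖R (∑ i ∈ Finset.range (l + 1), w i • h i) y‖
      = ‖∑ i ∈ Finset.range (l + 1), w i • R (h i) y‖ := by simp [map_sum]
    _ ≤ ∑ i ∈ Finset.range (l + 1), w i * ‖R (h i) y‖ := by
        refine (norm_sum_le _ _).trans_eq (Finset.sum_congr rfl fun i _ => ?_)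
        rw [norm_smul, Real.norm_of_nonneg (hw0 i)]
    _ ≤ ∑ i ∈ Finset.range (l + 1),
          ((if ε ≤ ‖R (h i) y‖ then a * (1 + 3 * δ) + ε else 0) + 2 * ε) :=
        Finset.sum_le_sum hterm
    _ = countLarge ε l (fun i => R (h i)) y * (a * (1 + 3 * δ) + ε) + (l + 1) * (2 * ε) := by
        rw [Finset.sum_add_distrib, ← Finset.sum_filter, Finset.sum_const, Finset.sum_const,
          Finset.card_range, nsmul_eq_mul, nsmul_eq_mul, countLarge]
        push_cast
        congr!
    _ ≤ k * (a * (1 + 3 * δ) + ε) + (l + 1) * (2 * ε) := by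
        have : (countLarge ε l (fun i => R (h i)) y : ℝ) ≤ k := by exact_mod_cast hcount
        gcongr

/-- Since `k ≤ l`, some image `R (h i)` is small at `y`. Changing the coefficient of `h i` in `2 h l
+ h 0` by `2` is then harmless at `y`, and brings the function down to norm about `1`. -/
theorem IsPeakChain.three_bound (hc : IsPeakChain R B k δ ε e l h x) (he : ‖e‖ = 1)
    (hδ : 0 ≤ δ) (hε : 0 ≤ ε) (hk : 1 ≤ k) (hkl : k ≤ l) (ha : 0 ≤ a) (hb : 0 ≤ b)
    (hup : ∀ u, ‖R u‖ ≤ a * ‖u‖) (hlow : ∀ u, ‖u‖ ≤ b * ‖R u‖)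
    (hB : ∀ u c, 0 ≤ c → (∀ y ∈ B, ‖R u y‖ ≤ c) → ‖R u‖ ≤ c) :
    3 * (1 - δ) ≤ b * (a * (1 + 5 * δ) + 2 * ε) := by
  classical
  have haδ := mul_nonneg ha hδ
  have h1 : 3 * (1 - δ) ≤ ‖(2 : ℝ) • h l + h 0‖ := by
    have h1 := hc.le_norm_sum he (w := fun i => (if i = 0 then 1 else 0) + if i = l then 2 else 0)
      fun i => by positivity
    have hl : 0 < l + 1 := by omega
    simp only [Finset.sum_add_distrib, add_smul, Finset.sum_ite_eq', ite_smul, zero_smul,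
      Finset.mem_range, hl, Nat.lt_succ_self, if_true, one_smul] at h1
    rw [add_comm ((2 : ℝ) • h l)]
    linarith
  refine h1.trans ((hlow _).trans (mul_le_mul_of_nonneg_left ?_ hb))
  refine hB _ _ (by positivity) fun y hy => ?_
  rw [map_add, map_smul, ContinuousMap.add_apply, ContinuousMap.smul_apply]
  obtain ⟨i, hil, hi⟩ := hc.exists_small hy hkl le_rfl
  rcases Nat.eq_zero_or_pos i with rfl | hi0
  · have h2 := norm_apply_le_of_norm_le hup ha
      (hc.norm_two_smul_sub_le he hδ (show 0 < l by omega) le_rfl) y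
    rw [map_sub, map_smul, ContinuousMap.sub_apply, ContinuousMap.smul_apply] at h2
    have h3 : (2 : ℝ) • R (h l) y + R (h 0) y =
        ((2 : ℝ) • R (h l) y - R (h 0) y) + (2 : ℝ) • R (h 0) y := by module
    have h4 := norm_add_le ((2 : ℝ) • R (h l) y - R (h 0) y) ((2 : ℝ) • R (h 0) y)
    rw [norm_smul, Real.norm_ofNat] at h4
    rw [h3]
    linarith
  rcases hil.eq_or_lt with rfl | hil
  · have h2 := norm_apply_le_of_norm_le hup ha (hc.norm_le 0 (Nat.zero_le _)) y
    have h4 := norm_add_le ((2 : ℝ) • R (h i) y) (R (h 0) y)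
    rw [norm_smul, Real.norm_ofNat] at h4
    linarith
  · have h2 := norm_apply_le_of_norm_le hup ha (hc.norm_alternating_le he hδ hi0 hil) y
    rw [map_sub, map_sub, map_smul, map_smul, ContinuousMap.sub_apply, ContinuousMap.sub_apply,
      ContinuousMap.smul_apply, ContinuousMap.smul_apply] at h2
    have h3 : (2 : ℝ) • R (h l) y + R (h 0) y =
        ((2 : ℝ) • R (h l) y - ((2 : ℝ) • R (h i) y - R (h 0) y)) + (2 : ℝ) • R (h i) y := by
      module
    have h4 := norm_add_le ((2 : ℝ) • R (h l) y - ((2 : ℝ) • R (h i) y - R (h 0) y))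
      ((2 : ℝ) • R (h i) y)
    rw [norm_smul, Real.norm_ofNat] at h4
    rw [h3]
    linarith

theorem le_of_forall_Ioo_le {f g : ℝ → ℝ} (hf : Continuous f) (hg : Continuous g)
    (h : ∀ t, 0 < t → t < 1 → f t ≤ g t) : f 0 ≤ g 0 := by
  refine le_of_tendsto_of_tendsto (hf.continuousWithinAt (s := Ioi 0)).tendsto
    (hg.continuousWithinAt (s := Ioi 0)).tendsto ?_
  filter_upwards [Ioo_mem_nhdsGT zero_lt_one] with t ht
  exact h t ht.1 ht.2

theorem exists_peakChain [T2Space K₁] [Nontrivial E₁] [CompleteSpace E₂]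
    (hE₂ : ¬ ContainsCopy E₂ (ZeroAtInftyContinuousMap ℕ ℝ))
    {H₂ : Submodule ℝ C(K₂, E₂)} (hR : ∀ u, R u ∈ H₂) (hB : IsClosed B)
    {W : Set K₁} (hW : W = iteratedDerivedSet (weakPeakPoints H) (l : Ordinal))
    {D : Set K₂} (hD : D = iteratedDerivedSet B (k : Ordinal) ∩ nonvanishingSet H₂)
    (hcases : (W.Nonempty ∧ D = ∅) ∨ (W.Infinite ∧ D.Finite) ∨
      (W.Finite ∧ D.Finite ∧ ¬ ContainsCopy (Fin D.ncard → E₂) (Fin W.ncard → E₁)))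
    (hδ : 0 < δ) (hδ1 : δ < 1) (hε : 0 < ε) :
    ∃ (e : E₁) (h : ℕ → H) (x : K₁), ‖e‖ = 1 ∧ IsPeakChain R B k δ ε e l h x := by
  have hWH : W ⊆ weakPeakPoints H := hW ▸ iteratedDerivedSet_natCast_subset _ l
  have hDfin : D.Finite := by
    rcases hcases with ⟨-, rfl⟩ | ⟨-, hD⟩ | ⟨-, hD, -⟩
    exacts [finite_empty, hD, hD]
  -- The starting function must have small image on `D`: vacuous for empty `D`, by disjoint peaks
  -- for infinite `W`, and by the absence of an embedding of powers for finite `W`.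
  obtain ⟨e, he, x, hx, h₀, hnear, hnorm, hsmall⟩ : ∃ e : E₁, ‖e‖ = 1 ∧ ∃ x ∈ W, ∃ h : H,
      ‖(h : C(K₁, E₁)) x - e‖ < δ ∧ ‖h‖ ≤ 1 + δ ∧ ∀ y ∈ D, ‖R h y‖ < ε := by
    obtain ⟨e, he⟩ := exists_norm_eq E₁ zero_le_one
    rcases hcases with ⟨⟨x, hx⟩, rfl⟩ | ⟨hWinf, -⟩ | ⟨hWfin, -, hno⟩
    · obtain ⟨f, hf, hf01, hfx, -⟩ := hWH hx univ univ_mem δ hδ hδ1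
      exact ⟨e, he, x, hx, tensorMem hf e, norm_tensorMem_sub_lt hf he hfx (hf01 x).2,
        (norm_tensorMem_le hf he hf01).trans (by linarith), fun y hy => absurd hy (notMem_empty y)⟩
    · obtain ⟨x, hx, f, hf, hf01, hfx, -, hsmall⟩ := exists_peak_small hE₂ R hWinf hWH isOpen_univ
        (subset_univ W) he hDfin hδ hδ1 hε
      exact ⟨e, he, x, hx, tensorMem hf e, norm_tensorMem_sub_lt hf he hfx (hf01 x).2,
        (norm_tensorMem_le hf he hf01).trans (by linarith), hsmall⟩
    · exact exists_finite_peak_small R hWfin hWH hDfin hno hδ hδ1 hε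
  rw [hD] at hsmall hDfin
  rw [hW] at hx
  obtain ⟨h, x', hc⟩ := (IsPeakChain.zero (k := k) (B := B) hR hε hnear hnorm hsmall).exists_chain
    hE₂ hR hB hDfin he hδ hδ1 hε hx
  rw [zero_add] at hc
  exact ⟨e, h, x', he, hc⟩

end Distortion

/-! ### The theorem, by letting the tolerances tend to zero -/

theorem theorem1p3
    {K₁ K₂ E₁ E₂ : Type*}
    [TopologicalSpace K₁] [CompactSpace K₁] [T2Space K₁]
    [TopologicalSpace K₂] [CompactSpace K₂] [T2Space K₂]
    [NormedAddCommGroup E₁] [NormedSpace ℝ E₁] [CompleteSpace E₁] [Nontrivial E₁]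
    [NormedAddCommGroup E₂] [NormedSpace ℝ E₂] [CompleteSpace E₂] [Nontrivial E₂]
    (H₁ : Submodule ℝ C(K₁, E₁)) (hH₁ : IsClosed (H₁ : Set C(K₁, E₁)))
    (H₂ : Submodule ℝ C(K₂, E₂)) (hH₂ : IsClosed (H₂ : Set C(K₂, E₂)))
    (hc₀ : ¬ ContainsCopy E₂ (ZeroAtInftyContinuousMap ℕ ℝ))
    (B : Set K₂) (hBclosed : IsClosed B) (hB : IsBoundaryFor B H₂)
    -- an into isomorphism `H₁ → H₂`, i.e. an isomorphism of `H₁` onto a linear subspace `F` of `H₂`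
    (F : Submodule ℝ C(K₂, E₂)) (hF : F ≤ H₂) (T : H₁ ≃L[ℝ] F)
    (l k : ℕ) (hk : 1 ≤ k) (hkl : k ≤ l)
    -- `W` is the derivative of order `l` of the set of weak peak points of `H₁`, as a subspace
    (W : Set K₁) (hW : W = CantorBendixson.iteratedDerivedSet (weakPeakPoints H₁) (l : Ordinal))
    -- `D` is the part of the derivative of order `k` of `B` on which `H₂` does not vanish
    (D : Set K₂)
    (hD : D = CantorBendixson.iteratedDerivedSet B (k : Ordinal) ∩ nonvanishingSet H₂)
    (hcases :
      (W.Nonempty ∧ D = ∅) ∨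
      (W.Infinite ∧ D.Finite) ∨
      (W.Finite ∧ D.Finite ∧ ¬ ContainsCopy (Fin D.ncard → E₂) (Fin W.ncard → E₁))) :
    max 3 ((2 * (l : ℝ) + 2 - (k : ℝ)) / (k : ℝ)) ≤
      ‖(T : H₁ →L[ℝ] F)‖ * ‖(T.symm : F →L[ℝ] H₁)‖ := by
  let R : H₁ →L[ℝ] C(K₂, E₂) := F.subtypeL.comp (T : H₁ →L[ℝ] F)
  set a := ‖(T : H₁ →L[ℝ] F)‖
  set b := ‖(T.symm : F →L[ℝ] H₁)‖
  have ha : 0 ≤ a := norm_nonneg _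
  have hb : 0 ≤ b := norm_nonneg _
  have hR : ∀ u, R u ∈ H₂ := fun u => hF (T u).2
  have hup : ∀ u, ‖R u‖ ≤ a * ‖u‖ := fun u => (T : H₁ →L[ℝ] F).le_opNorm u
  have hlow : ∀ u, ‖u‖ ≤ b * ‖R u‖ := fun u => by
    have := (T.symm : F →L[ℝ] H₁).le_opNorm (T u)
    rwa [ContinuousLinearEquiv.coe_coe, T.symm_apply_apply] at this
  have hbd : ∀ u c, 0 ≤ c → (∀ y ∈ B, ‖R u y‖ ≤ c) → ‖R u‖ ≤ c := fun u c hc h => by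
    rw [hB (R u) (hR u)]
    exact Real.iSup_le (fun y => h y y.2) hc
  have hk0 : (0 : ℝ) < k := by exact_mod_cast hk
  have key : ∀ δ : ℝ, 0 < δ → δ < 1 →
      (2 * l + 2 - k) * (1 - δ) ≤ b * (k * (a * (1 + 3 * δ) + δ) + (l + 1) * (2 * δ)) ∧
        3 * (1 - δ) ≤ b * (a * (1 + 5 * δ) + 2 * δ) := fun δ hδ hδ1 => by
    obtain ⟨e, h, x, he, hc⟩ := exists_peakChain hc₀ hR hBclosed hW hD hcases hδ hδ1 hδ
    exact ⟨hc.weighted_bound he hδ.le hδ.le hkl ha hb hup hlow hbd,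
      hc.three_bound he hδ.le hδ.le hk hkl ha hb hup hlow hbd⟩
  refine max_le ?_ ?_
  · have := le_of_forall_Ioo_le (f := fun δ => 3 * (1 - δ))
      (g := fun δ => b * (a * (1 + 5 * δ) + 2 * δ)) (by fun_prop) (by fun_prop)
      fun δ hδ hδ1 => (key δ hδ hδ1).2
    simp only [mul_zero, sub_zero, add_zero, mul_one] at this
    linarith
  · have := le_of_forall_Ioo_le (f := fun δ => (2 * l + 2 - k) * (1 - δ))
      (g := fun δ => b * (k * (a * (1 + 3 * δ) + δ) + (l + 1) * (2 * δ))) (by fun_prop)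
      (by fun_prop) fun δ hδ hδ1 => (key δ hδ hδ1).1
    simp only [mul_zero, sub_zero, add_zero, mul_one] at this
    rw [div_le_iff₀ hk0]
    linarith
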